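/- Let $l\neq 4$, let $d$ be even with $0\le d\le l$, and consider $\mathfrak g=\mathfrak{sp}(l,\mathbb R)$ (type $C_l$) with simple roots $\lambda_1-\lambda_2,\dots,\lambda_{l-1}-\lambda_l,2\lambda_l$. Put $\Theta=\{\lambda_{d+1}-\lambda_{d+2},\dots,\lambda_{l-1}-\lambda_l,2\lambda_l\}$ (so $\Theta=\emptyset$ if $d=l$). Let $K\cong U(l)$ be the maximal compact subgroup $Sp(l,\mathbb R)\cap O(2l)$, $\mathfrak k\cong\mathfrak u(l)$ its Lie algebra (the matrix $\begin{pmatrix}A&-B\\B&A\end{pmatrix}$ corresponding to $A+iB$), $\mathfrak p_\Theta$ the parabolic subalgebra of $\Theta$, $K_\Theta$ the normalizer of $\mathfrak p_\Theta$ in $K$, and $\mathbb F_\Theta=K/K_\Theta$ the real flag manifold. For a positive root $\alpha$ let $\mathfrak k_\alpha=(\mathfrak g_\alpha\oplus\mathfrak g_{-\alpha})\cap\mathfrak k$. Let $\mathfrak k_\Theta$ (resp. $\mathfrak m_\Theta$) be the sum of the $\mathfrak k_\alpha$ over the positive roots generated (resp. not generated) by $\Theta$. Then $\mathfrak k=\mathfrak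 k_\Theta\oplus\mathfrak m_\Theta$, $\mathfrak m_\Theta$ is identified with the tangent space of $\mathbb F_\Theta$ at the origin, and $X_{\mathfrak m}$ denotes the $\mathfrak m_\Theta$-component of $X\in\mathfrak k$. Put $A_{kj}=E_{kj}-E_{jk}$ and $S_{kj}=i(E_{kj}+E_{jk})$ in $\mathfrak u(l)$. An endomorphism $J$ of $\mathfrak m_\Theta$ with $J^2=-1$ is called integrable if $$[JX,JY]_{\mathfrak m}-[X,Y]_{\mathfrak m}-J[JX,Y]_{\mathfrak m}-J[X,JY]_{\mathfrak m}=0\quad\text{for all }X,Y\in\mathfrak m_\Theta,$$ and $K_\Theta$-invariant if it commutes with $\mathrm{Ad}(K_\Theta)$ on $\mathfrak m_\Theta$. Let $J:\mathfrak m_\Theta\to\mathfrak m_\Theta$ be linear with $J^2=-1$, preserving $\mathfrak k_{2\lambda_1}\oplus\dots\oplus\mathfrak k_{2\lambda_d}$, and with $JA_{kj}=\mu_{kj}S_{kj}$, $JS_{kj}=-\mu_{kj}A_{kj}$, $\mu_{kj}=\pm1$, for all $1\le j\le d$ and $j<k\le l$. Then $J$ is $K_\Theta$-invariant and integrable if and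 only if both of the following hold: 1. for each $j=1,\dots,d$ there is $\varepsilon_j=\pm1$ with $\mu_{kj}=\varepsilon_j$ for all $k=d+1,\dots,l$; 2. for all $k>j>s$ with $j,s\in\{1,\dots,d\}$, the triple $(\mu_{ks},\mu_{kj},\mu_{js})$ is one of $(\mu_{ks},\mu_{ks},\mu_{ks})$, $(\mu_{ks},-\mu_{ks},\mu_{ks})$, $(\mu_{ks},\mu_{ks},-\mu_{ks})$. Conversely, every $K$-invariant complex structure (i.e. integrable $K$-invariant almost complex structure) on $\mathbb F_\Theta$ is induced, at the origin, by some $J$ as above satisfying 1 and 2. -/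

import Mathlib

attribute [local instance 100] LieRing.ofAssociativeRing

/-!
Real flag manifolds of type `C_l`, that is, of `𝔤 = 𝔰𝔭(l, ℝ)`, realised by real `2l × 2l`
matrices. The index `i : Fin l` (values `0, …, l - 1`) stands for the classical index `i + 1`.
-/

namespace FlagC

/-- Real `2l × 2l` matrices, in `l × l` blocks. -/
abbrev Mat (l : ℕ) : Type := Matrix (Fin l ⊕ Fin l) (Fin l ⊕ Fin l) ℝ

/-- The split real form `𝔤 = 𝔰𝔭(l, ℝ)` of `C_l`. -/
abbrev sp (l : ℕ) : LieSubalgebra ℝ (Mat l) := LieAlgebra.Symplectic.sp (Fin l) ℝ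

/-- The maximal compact subalgebra `𝔨 = 𝔰𝔭(l, ℝ) ∩ 𝔰𝔬(2l)`, isomorphic to `𝔲(l)`. -/
def kAlg (l : ℕ) : LieSubalgebra ℝ (Mat l) :=
  sp l ⊓ LieAlgebra.Orthogonal.so (Fin l ⊕ Fin l) ℝ

/-! ### Roots -/

/-- The element `diag(h, -h)` of the Cartan subalgebra `𝔞`. -/
def cartanElt {l : ℕ} (h : Fin l → ℝ) : Mat l := Matrix.diagonal (Sum.elim h (-h))

/-- The Cartan subalgebra `𝔞` of the diagonal matrices in `𝔰𝔭(l, ℝ)`. -/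
def cartan (l : ℕ) : Submodule ℝ (Mat l) := Submodule.span ℝ (Set.range cartanElt)

/-- The functional `λ_i : diag(h, -h) ↦ h_i`. Integral functionals on `𝔞` are given by their
coordinates with respect to `λ_1, …, λ_l`. -/
def lam {l : ℕ} (i : Fin l) : Fin l → ℤ := Pi.single i 1

/-- `𝔤_α = {X ∈ 𝔤 : [H, X] = α(H) X for all H ∈ 𝔞}`. -/
def rootSpace {l : ℕ} (α : Fin l → ℤ) : Submodule ℝ (Mat l) where
  carrier := {X | X ∈ sp l ∧ ∀ h : Fin l → ℝ, ⁅cartanElt h, X⁆ = (∑ i, (α i : ℝ) * h i) • X}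
  zero_mem' := ⟨zero_mem _, fun h => by simp⟩
  add_mem' := fun hX hY =>
    ⟨add_mem hX.1 hY.1, fun h => by rw [lie_add, hX.2 h, hY.2 h, smul_add]⟩
  smul_mem' := fun c X hX =>
    ⟨(sp l).smul_mem c hX.1, fun h => by rw [lie_smul, hX.2 h, smul_comm]⟩

/-- The positive roots `λ_i - λ_j` (`i < j`), `λ_i + λ_j` (`i < j`) and `2λ_i`. -/
def posRoots (l : ℕ) : Set (Fin l → ℤ) :=
  {α | (∃ i j, i < j ∧ α = lam i - lam j) ∨ ∃ i j, i ≤ j ∧ α = lam i + lam j}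

/-- `Θ = {λ_{d+1} - λ_{d+2}, …, λ_{l-1} - λ_l, 2λ_l}`; it is empty for `d = l`, and consists of
all simple roots for `d = 0`. -/
def theta (l d : ℕ) : Set (Fin l → ℤ) :=
  {α | (∃ i j : Fin l, d ≤ i.val ∧ i.val + 1 = j.val ∧ α = lam i - lam j) ∨
    ∃ i : Fin l, d ≤ i.val ∧ i.val + 1 = l ∧ α = lam i + lam i}

/-- `⟨Θ⟩⁺`, the positive roots generated by `Θ`. -/
def thetaPos (l d : ℕ) : Set (Fin l → ℤ) :=
  posRoots l ∩ (AddSubmonoid.closure (theta l d) : Set (Fin l → ℤ))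

/-- The parabolic subalgebra `𝔭_Θ = 𝔞 ⊕ ∑_{α > 0} 𝔤_α ⊕ ∑_{α ∈ ⟨Θ⟩⁺} 𝔤_{-α}`. -/
def parab (l d : ℕ) : Submodule ℝ (Mat l) :=
  cartan l ⊔ (⨆ α ∈ posRoots l, rootSpace α) ⊔ ⨆ α ∈ thetaPos l d, rootSpace (-α)

/-! ### The groups `K` and `K_Θ` -/

/-- `K = Sp(l, ℝ) ∩ O(2l) ≅ U(l)`, acting on `𝔤` by conjugation. -/
def K (l : ℕ) : Subgroup (Mat l)ˣ :=
  (Matrix.symplecticGroup (Fin l) ℝ ⊓ Matrix.orthogonalGroup (Fin l ⊕ Fin l) ℝ).units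

/-- `Ad(g) X = g X g⁻¹`. -/
def Ad {l : ℕ} (g : (Mat l)ˣ) : Mat l →ₗ[ℝ] Mat l where
  toFun X := (g : Mat l) * X * ((g⁻¹ : (Mat l)ˣ) : Mat l)
  map_add' X Y := by rw [mul_add, add_mul]
  map_smul' c X := by simp

theorem Ad_mul {l : ℕ} (g h : (Mat l)ˣ) : Ad (g * h) = Ad g ∘ₗ Ad h := by
  ext1 X
  simp [Ad, mul_assoc]

theorem Ad_one {l : ℕ} : Ad (1 : (Mat l)ˣ) = LinearMap.id := by
  ext1 X
  simp [Ad]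

theorem Ad_mem_kAlg {l : ℕ} {g : (Mat l)ˣ} (hg : g ∈ K l) {X : Mat l} (hX : X ∈ kAlg l) :
    Ad g X ∈ kAlg l := by
  have hgK := (Submonoid.mem_units_iff _ _).1 hg
  have ho : (g : Mat l).transpose * g = 1 := (Matrix.mem_orthogonalGroup_iff' _ _).1 hgK.1.2
  have hi : ((g⁻¹ : (Mat l)ˣ) : Mat l) = (g : Mat l).transpose :=
    Units.inv_eq_of_mul_eq_one_left ho
  have hJ : (g : Mat l) * Matrix.J (Fin l) ℝ * (g : Mat l).transpose = Matrix.J (Fin l) ℝ :=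
    SymplecticGroup.mem_iff.1 hgK.1.1
  have h1 : X ∈ skewAdjointMatricesLieSubalgebra (Matrix.J (Fin l) ℝ) := hX.1
  have h2 : X ∈ LieAlgebra.Orthogonal.so (Fin l ⊕ Fin l) ℝ := hX.2
  rw [mem_skewAdjointMatricesLieSubalgebra, mem_skewAdjointMatricesSubmodule,
    Matrix.IsSkewAdjoint, Matrix.IsAdjointPair] at h1
  rw [LieAlgebra.Orthogonal.mem_so] at h2
  have ht : (Ad g X).transpose = -Ad g X := by
    simp [Ad, hi, h2, mul_assoc]
  refine ⟨?_, ?_⟩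
  · change _ ∈ skewAdjointMatricesLieSubalgebra (Matrix.J (Fin l) ℝ)
    rw [mem_skewAdjointMatricesLieSubalgebra, mem_skewAdjointMatricesSubmodule,
      Matrix.IsSkewAdjoint, Matrix.IsAdjointPair, ht]
    rw [h2] at h1
    have e1 : Ad g X * Matrix.J (Fin l) ℝ =
        g * (X * Matrix.J (Fin l) ℝ) * (g : Mat l).transpose := by
      conv_lhs => rw [← hJ]
      change g * X * ((g⁻¹ : (Mat l)ˣ) : Mat l) * _ = _
      rw [hi]
      simp only [mul_assoc]
      rw [← mul_assoc (g : Mat l).transpose, ho, one_mul]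
    have e2 : Matrix.J (Fin l) ℝ * Ad g X =
        g * (Matrix.J (Fin l) ℝ * X) * (g : Mat l).transpose := by
      conv_lhs => rw [← hJ]
      change _ * (g * X * ((g⁻¹ : (Mat l)ˣ) : Mat l)) = _
      rw [hi]
      simp only [mul_assoc]
      rw [← mul_assoc (g : Mat l).transpose g, ho, one_mul]
    have e3 : X * Matrix.J (Fin l) ℝ = Matrix.J (Fin l) ℝ * X := by simpa using h1
    rw [neg_mul, mul_neg, e1, e2, e3]
  · change _ ∈ LieAlgebra.Orthogonal.so (Fin l ⊕ Fin l) ℝ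
    rw [LieAlgebra.Orthogonal.mem_so]
    exact ht

/-- The adjoint action of `K` on `𝔨`. -/
def AdK {l : ℕ} (g : K l) : kAlg l →ₗ[ℝ] kAlg l where
  toFun X := ⟨Ad g.1 X, Ad_mem_kAlg g.2 X.2⟩
  map_add' X Y := Subtype.ext (map_add (Ad g.1) (X : Mat l) Y)
  map_smul' c X := Subtype.ext (map_smul (Ad g.1) c (X : Mat l))

/-- `K_Θ = K ∩ P_Θ`, where `P_Θ` is the normalizer of `𝔭_Θ`. -/
def KTheta (l d : ℕ) : Subgroup (Mat l)ˣ where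
  carrier := {g | g ∈ K l ∧ (parab l d).map (Ad g) = parab l d}
  one_mem' := ⟨one_mem _, by rw [Ad_one, Submodule.map_id]⟩
  mul_mem' := fun hg hh =>
    ⟨mul_mem hg.1 hh.1, by rw [Ad_mul, Submodule.map_comp, hh.2, hg.2]⟩
  inv_mem' := fun {g} hg => ⟨inv_mem hg.1, by
    conv_lhs => rw [← hg.2]
    rw [← Submodule.map_comp, ← Ad_mul, inv_mul_cancel, Ad_one, Submodule.map_id]⟩

/-! ### The decomposition `𝔨 = 𝔨_Θ ⊕ 𝔪_Θ` -/

/-- `𝔨_α = (𝔤_α ⊕ 𝔤_{-α}) ∩ 𝔨`, as a subspace of `𝔨`. -/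
def kRoot {l : ℕ} (α : Fin l → ℤ) : Submodule ℝ (kAlg l) :=
  (rootSpace α ⊔ rootSpace (-α)).comap (kAlg l).toSubmodule.subtype

/-- `𝔨_Θ`, the sum of the `𝔨_α` with `α ∈ ⟨Θ⟩⁺`. -/
def kTheta (l d : ℕ) : Submodule ℝ (kAlg l) := ⨆ α ∈ thetaPos l d, kRoot α

/-- `𝔪_Θ`, the sum of the `𝔨_α` with `α` a positive root outside `⟨Θ⟩⁺`. -/
def mTheta (l d : ℕ) : Submodule ℝ (kAlg l) := ⨆ α ∈ posRoots l \ thetaPos l d, kRoot α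

/-- `𝔨_{2λ_1} ⊕ ⋯ ⊕ 𝔨_{2λ_d}`. -/
def longPart (l d : ℕ) : Submodule ℝ (kAlg l) :=
  ⨆ (i : Fin l) (_ : i.val < d), kRoot (lam i + lam i)

/-- The real `2l × 2l` matrix of the complex matrix `A + i B`. -/
def ofComplex {l : ℕ} (A B : Matrix (Fin l) (Fin l) ℝ) : Mat l := Matrix.fromBlocks A (-B) B A

theorem ofComplex_mem {l : ℕ} {A B : Matrix (Fin l) (Fin l) ℝ} (hA : A.transpose = -A)
    (hB : B.transpose = B) : ofComplex A B ∈ kAlg l := by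
  refine ⟨?_, ?_⟩
  · change ofComplex A B ∈ skewAdjointMatricesLieSubalgebra (Matrix.J (Fin l) ℝ)
    rw [mem_skewAdjointMatricesLieSubalgebra, mem_skewAdjointMatricesSubmodule]
    simp [Matrix.IsSkewAdjoint, Matrix.IsAdjointPair, Matrix.J, ofComplex,
      Matrix.fromBlocks_transpose, Matrix.fromBlocks_multiply, Matrix.fromBlocks_neg, hA, hB]
  · change ofComplex A B ∈ LieAlgebra.Orthogonal.so (Fin l ⊕ Fin l) ℝ
    rw [LieAlgebra.Orthogonal.mem_so]
    simp [ofComplex, Matrix.fromBlocks_transpose, Matrix.fromBlocks_neg, hA, hB]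

/-- `A_{kj} = E_{kj} - E_{jk}`, an element of `𝔨 ≅ 𝔲(l)`. -/
def A {l : ℕ} (k j : Fin l) : kAlg l :=
  ⟨ofComplex (Matrix.single k j 1 - Matrix.single j k 1) 0, ofComplex_mem (by simp) (by simp)⟩

/-- `S_{kj} = i (E_{kj} + E_{jk})`, an element of `𝔨 ≅ 𝔲(l)`. -/
def S {l : ℕ} (k j : Fin l) : kAlg l :=
  ⟨ofComplex 0 (Matrix.single k j 1 + Matrix.single j k 1),
    ofComplex_mem (by simp) (by simp [add_comm])⟩

/-! The facts below show that `A_{kj}` and `S_{kj}` lie in `𝔪_Θ`, and that `𝔨 = 𝔨_Θ ⊕ 𝔪_Θ`. -/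

/-- The weight of a basis vector of `ℝ^{2l}`. -/
def wt {l : ℕ} : Fin l ⊕ Fin l → Fin l → ℤ := Sum.elim lam (fun i => -lam i)

theorem entry_eq {l : ℕ} {α : Fin l → ℤ} {X : Mat l} (hX : X ∈ rootSpace α)
    (a b : Fin l ⊕ Fin l) (h : X a b ≠ 0) : α = wt a - wt b := by
  funext i
  have h1 := congrFun (congrFun (hX.2 (Pi.single i 1)) a) b
  rw [Ring.lie_def] at h1
  simp only [cartanElt, Matrix.sub_apply, Matrix.diagonal_mul, Matrix.mul_diagonal,
    Matrix.smul_apply, smul_eq_mul] at h1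
  have h2 : (∑ j, (α j : ℝ) * (Pi.single i 1 : Fin l → ℝ) j) = α i := by
    rw [Finset.sum_eq_single i] <;> simp +contextual
  have key : ∀ c : Fin l ⊕ Fin l,
      Sum.elim (Pi.single i 1 : Fin l → ℝ) (-Pi.single i 1) c = ((wt c i : ℤ) : ℝ) := by
    rintro (c | c) <;> by_cases hc : c = i <;>
      simp [wt, lam, hc]
  rw [h2, key, key] at h1
  have h3 : ((wt a i : ℝ) - wt b i - α i) * X a b = 0 := by linarith
  have h4 := (mul_eq_zero.1 h3).resolve_right h
  have : ((α i : ℤ) : ℝ) = ((wt a i - wt b i : ℤ) : ℝ) := by push_cast; linarith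
  exact_mod_cast this

theorem mem_rootSpace {l : ℕ} {α : Fin l → ℤ} {X : Mat l} (hs : X ∈ sp l)
    (h : ∀ a b, X a b ≠ 0 → α = wt a - wt b) : X ∈ rootSpace α := by
  refine ⟨hs, fun t => ?_⟩
  ext a b
  rw [Ring.lie_def]
  simp only [cartanElt, Matrix.sub_apply, Matrix.diagonal_mul, Matrix.mul_diagonal,
    Matrix.smul_apply, smul_eq_mul]
  by_cases hX : X a b = 0
  · simp [hX]
  have key : ∀ c : Fin l ⊕ Fin l, ∑ i, ((wt c i : ℤ) : ℝ) * t i = Sum.elim t (-t) c := by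
    rintro (c | c)
    · simp only [wt, lam, Sum.elim_inl]
      rw [Finset.sum_eq_single c] <;> simp +contextual
    · simp only [wt, lam, Sum.elim_inr]
      rw [Finset.sum_eq_single c] <;> simp +contextual
  rw [h a b hX]
  simp only [Pi.sub_apply, Int.cast_sub, sub_mul, Finset.sum_sub_distrib, key]
  ring

theorem fromBlocks_mem_sp {l : ℕ} {P Q R T : Matrix (Fin l) (Fin l) ℝ}
    (hR : R.transpose = R) (hP : P.transpose = -T) (hQ : Q.transpose = Q) :
    Matrix.fromBlocks P Q R T ∈ sp l := by
  change _ ∈ skewAdjointMatricesLieSubalgebra (Matrix.J (Fin l) ℝ)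
  rw [mem_skewAdjointMatricesLieSubalgebra, mem_skewAdjointMatricesSubmodule]
  have hT : T.transpose = -P := by
    rw [← neg_neg T, ← hP, Matrix.transpose_neg, Matrix.transpose_transpose]
  simp [Matrix.IsSkewAdjoint, Matrix.IsAdjointPair, Matrix.J, Matrix.fromBlocks_transpose,
    Matrix.fromBlocks_multiply, Matrix.fromBlocks_neg, hR, hP, hQ, hT]

theorem A_mem_kRoot {l : ℕ} (k j : Fin l) : A k j ∈ kRoot (lam j - lam k) := by
  change (A k j : Mat l) ∈ rootSpace (lam j - lam k) ⊔ rootSpace (-(lam j - lam k))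
  have : (A k j : Mat l) =
      -Matrix.fromBlocks (Matrix.single j k 1) 0 0 (-Matrix.single k j 1) +
        Matrix.fromBlocks (Matrix.single k j 1) 0 0 (-Matrix.single j k 1) := by
    simp [A, ofComplex, Matrix.fromBlocks_neg, Matrix.fromBlocks_add, sub_eq_add_neg, add_comm]
  rw [this]
  refine Submodule.add_mem_sup (neg_mem (mem_rootSpace (fromBlocks_mem_sp (by simp) (by simp) (by simp)) ?_))
    (mem_rootSpace (fromBlocks_mem_sp (by simp) (by simp) (by simp)) ?_)
  · rintro (a | a) (b | b) h <;> simp [Matrix.single_apply] at h <;>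
      simp [wt, h.1, h.2, add_comm, sub_eq_add_neg]
  · rintro (a | a) (b | b) h <;> simp [Matrix.single_apply] at h <;>
      simp [wt, h.1, h.2, add_comm, sub_eq_add_neg]

theorem S_mem_kRoot {l : ℕ} (k j : Fin l) : S k j ∈ kRoot (lam j + lam k) := by
  change (S k j : Mat l) ∈ rootSpace (lam j + lam k) ⊔ rootSpace (-(lam j + lam k))
  have : (S k j : Mat l) =
      -Matrix.fromBlocks 0 (Matrix.single k j 1 + Matrix.single j k 1) 0 0 +
        Matrix.fromBlocks 0 0 (Matrix.single k j 1 + Matrix.single j k 1) 0 := by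
    simp [S, ofComplex, Matrix.fromBlocks_neg, Matrix.fromBlocks_add, add_comm]
  rw [this]
  have hx : ∀ a b : Fin l, Matrix.single k j (1 : ℝ) a b + Matrix.single j k 1 a b ≠ 0 →
      (k = a ∧ j = b) ∨ (j = a ∧ k = b) := by
    intro a b h
    by_contra! hc
    apply h
    rw [Matrix.single_apply, Matrix.single_apply, if_neg (by tauto), if_neg (by tauto), add_zero]
  refine Submodule.add_mem_sup
    (neg_mem (mem_rootSpace (fromBlocks_mem_sp (by simp [add_comm]) (by simp) (by simp [add_comm])) ?_))
    (mem_rootSpace (fromBlocks_mem_sp (by simp [add_comm]) (by simp) (by simp [add_comm])) ?_)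
  · rintro (a | a) (b | b) h
    · simp at h
    · obtain ⟨rfl, rfl⟩ | ⟨rfl, rfl⟩ := hx a b (by simpa using h) <;> simp [wt, add_comm]
    · simp at h
    · simp at h
  · rintro (a | a) (b | b) h
    · simp at h
    · simp at h
    · obtain ⟨rfl, rfl⟩ | ⟨rfl, rfl⟩ := hx a b (by simpa using h) <;>
        simp [wt, add_comm, sub_eq_add_neg]
    · simp at h

theorem eq_zero_of_mem_closure {l d : ℕ} {α : Fin l → ℤ}
    (h : α ∈ AddSubmonoid.closure (theta l d)) (i : Fin l) (hi : i.val < d) : α i = 0 := by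
  induction h using AddSubmonoid.closure_induction with
  | mem x hx =>
    rcases hx with ⟨a, b, ha, hb, rfl⟩ | ⟨a, ha, -, rfl⟩
    · have h1 : i ≠ a := fun e => by subst e; omega
      have h2 : i ≠ b := fun e => by subst e; omega
      simp [lam, h1, h2]
    · have h1 : i ≠ a := fun e => by subst e; omega
      simp [lam, h1]
  | zero => rfl
  | add x y _ _ hx hy => simp [hx, hy]

theorem sub_mem_closure {l d : ℕ} (i j : Fin l) (hi : d ≤ i.val) (hij : i.val ≤ j.val) :
    lam i - lam j ∈ AddSubmonoid.closure (theta l d) := by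
  obtain ⟨n, hn⟩ := Nat.exists_eq_add_of_le hij
  induction n generalizing j with
  | zero =>
    have : i = j := Fin.ext (by omega)
    simp [this]
  | succ n ih =>
    have h1 := ih ⟨i.val + n, by omega⟩ (by simp) rfl
    have h2 : lam (⟨i.val + n, by omega⟩ : Fin l) - lam j ∈ AddSubmonoid.closure (theta l d) :=
      AddSubmonoid.subset_closure
        (Or.inl ⟨⟨i.val + n, by omega⟩, j, by simp; omega, by simp; omega, rfl⟩)
    simpa using add_mem h1 h2

theorem add_mem_closure {l d : ℕ} (i j : Fin l) (hi : d ≤ i.val) (hj : d ≤ j.val) :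
    lam i + lam j ∈ AddSubmonoid.closure (theta l d) := by
  have hl : l - 1 < l := by omega
  have h1 := sub_mem_closure i ⟨l - 1, hl⟩ hi (by simp; omega)
  have h2 := sub_mem_closure j ⟨l - 1, hl⟩ hj (by simp; omega)
  have h3 : lam (⟨l - 1, hl⟩ : Fin l) + lam ⟨l - 1, hl⟩ ∈ AddSubmonoid.closure (theta l d) :=
    AddSubmonoid.subset_closure (Or.inr ⟨⟨l - 1, hl⟩, by simp; omega, by simp; omega, rfl⟩)
  have h4 := add_mem (add_mem h1 h2) h3
  convert h4 using 1
  abel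

theorem mem_thetaPos_of_support {l d : ℕ} {α : Fin l → ℤ} (hα : α ∈ posRoots l)
    (h : ∀ i : Fin l, i.val < d → α i = 0) : α ∈ thetaPos l d := by
  refine ⟨hα, ?_⟩
  rcases hα with ⟨i, j, hij, rfl⟩ | ⟨i, j, hij, rfl⟩
  · refine sub_mem_closure i j ?_ hij.le
    by_contra! hd
    have := h i hd
    simp [lam, hij.ne] at this
  · have hi : d ≤ i.val := by
      by_contra! hd
      have := h i hd
      by_cases e : i = j <;> simp [lam, e] at this
    exact add_mem_closure i j hi (hi.trans hij)

theorem ne_zero_of_mem_posRoots {l : ℕ} {α : Fin l → ℤ} (hα : α ∈ posRoots l) : α ≠ 0 := by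
  rintro rfl
  rcases hα with ⟨i, j, hij, h⟩ | ⟨i, j, hij, h⟩
  · have := congrFun h i
    simp [lam, hij.ne] at this
  · have := congrFun h i
    by_cases e : i = j <;> simp [lam, e] at this

/-- The elements of `𝔨` whose entries at the positions in `P` vanish. -/
def zeroOn {l : ℕ} (P : Fin l ⊕ Fin l → Fin l ⊕ Fin l → Prop) : Submodule ℝ (kAlg l) where
  carrier := {X | ∀ a b, P a b → (X : Mat l) a b = 0}
  zero_mem' := fun _ _ _ => rfl
  add_mem' := fun {X Y} hX hY a b h => by
    change (X : Mat l) a b + (Y : Mat l) a b = 0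
    rw [hX a b h, hY a b h, add_zero]
  smul_mem' := fun c X hX a b h => by
    change c * (X : Mat l) a b = 0
    rw [hX a b h, mul_zero]

/-- The underlying index of a basis vector of `ℝ^{2l}`. -/
def idx {l : ℕ} : Fin l ⊕ Fin l → Fin l := Sum.elim id id

theorem kRoot_le_zeroOn {l : ℕ} {α : Fin l → ℤ} {P : Fin l ⊕ Fin l → Fin l ⊕ Fin l → Prop}
    (h : ∀ a b, P a b → α ≠ wt a - wt b ∧ -α ≠ wt a - wt b) : kRoot α ≤ zeroOn P := by
  intro X hX a b hab
  obtain ⟨Y, hY, Z, hZ, hYZ⟩ := Submodule.mem_sup.1 (Submodule.mem_comap.1 hX)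
  have h1 : Y a b = 0 := by
    by_contra hc
    exact (h a b hab).1 (entry_eq hY a b hc)
  have h2 : Z a b = 0 := by
    by_contra hc
    exact (h a b hab).2 (entry_eq hZ a b hc)
  change ((kAlg l).toSubmodule.subtype X) a b = 0
  rw [← hYZ, Matrix.add_apply, h1, h2, add_zero]

theorem wt_eq_zero {l : ℕ} (a : Fin l ⊕ Fin l) (i : Fin l) (h : i ≠ idx a) : wt a i = 0 := by
  rcases a with a | a <;> simp [idx] at h <;> simp [wt, lam, h]

theorem wt_eq_of {l : ℕ} (a b : Fin l ⊕ Fin l) (h : wt a (idx a) = wt b (idx a)) : a = b := by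
  by_cases e : idx a = idx b
  · rcases a with a | a <;> rcases b with b | b <;> simp [idx] at e <;> subst e <;>
      simp [wt, idx, lam] at h ⊢ <;> omega
  · rw [wt_eq_zero b _ e] at h
    rcases a with a | a <;> simp [wt, idx, lam] at h

theorem kTheta_le {l d : ℕ} :
    kTheta l d ≤ zeroOn (fun a b => (idx a).val < d ∨ (idx b).val < d) := by
  refine iSup₂_le fun α hα => kRoot_le_zeroOn fun a b hab => ?_
  have h0 := eq_zero_of_mem_closure hα.2
  have hne := ne_zero_of_mem_posRoots hα.1
  have key : ∀ β : Fin l → ℤ, β ≠ 0 → (∀ i : Fin l, i.val < d → β i = 0) →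
      β ≠ wt a - wt b := by
    rintro β hβ hz rfl
    apply hβ
    have hs : a = b := by
      rcases hab with hab | hab
      · exact wt_eq_of a b (sub_eq_zero.1 (hz _ hab))
      · exact (wt_eq_of b a (sub_eq_zero.1 (hz _ hab)).symm).symm
    rw [hs, sub_self]
  exact ⟨key α hne h0, key (-α) (neg_ne_zero.2 hne) fun i hi => by simp [h0 i hi]⟩

theorem mTheta_le {l d : ℕ} :
    mTheta l d ≤ zeroOn (fun a b => d ≤ (idx a).val ∧ d ≤ (idx b).val) := by
  refine iSup₂_le fun α hα => kRoot_le_zeroOn fun a b hab => ?_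
  have hz : ∀ i : Fin l, i.val < d → (wt a - wt b) i = 0 := by
    intro i hi
    have h1 : i ≠ idx a := fun e => by subst e; omega
    have h2 : i ≠ idx b := fun e => by subst e; omega
    simp [wt_eq_zero a i h1, wt_eq_zero b i h2]
  constructor
  · intro e
    exact hα.2 (mem_thetaPos_of_support hα.1 fun i hi => e ▸ hz i hi)
  · intro e
    refine hα.2 (mem_thetaPos_of_support hα.1 fun i hi => ?_)
    have := hz i hi
    rw [← e, Pi.neg_apply, neg_eq_zero] at this
    exact this

theorem kRoot_le_sup {l d : ℕ} {α : Fin l → ℤ} (hα : α ∈ posRoots l) :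
    kRoot α ≤ mTheta l d ⊔ kTheta l d := by
  by_cases h : α ∈ thetaPos l d
  · exact le_sup_of_le_right (le_iSup₂_of_le α h le_rfl)
  · exact le_sup_of_le_left (le_iSup₂_of_le α ⟨hα, h⟩ le_rfl)

theorem A_swap {l : ℕ} (k j : Fin l) : A j k = -A k j := by
  apply Subtype.ext
  simp [A, ofComplex, Matrix.fromBlocks_neg]

theorem S_swap {l : ℕ} (k j : Fin l) : S j k = S k j := by
  apply Subtype.ext
  simp [S, add_comm]

theorem A_mem_sup {l d : ℕ} (k j : Fin l) : A k j ∈ mTheta l d ⊔ kTheta l d := by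
  rcases lt_trichotomy j k with h | h | h
  · exact kRoot_le_sup (Or.inl ⟨j, k, h, rfl⟩) (A_mem_kRoot k j)
  · have : A k j = 0 := by
      subst h
      apply Subtype.ext
      simp [A, ofComplex]
    rw [this]
    exact zero_mem _
  · rw [A_swap]
    exact neg_mem (kRoot_le_sup (Or.inl ⟨k, j, h, rfl⟩) (A_mem_kRoot j k))

theorem S_mem_sup {l d : ℕ} (k j : Fin l) : S k j ∈ mTheta l d ⊔ kTheta l d := by
  rcases le_total j k with h | h
  · exact kRoot_le_sup (Or.inr ⟨j, k, h, rfl⟩) (S_mem_kRoot k j)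
  · rw [S_swap]
    exact kRoot_le_sup (Or.inr ⟨k, j, h, rfl⟩) (S_mem_kRoot j k)

theorem exists_ofComplex {l : ℕ} (X : kAlg l) : ∃ P Q : Matrix (Fin l) (Fin l) ℝ,
    P.transpose = -P ∧ Q.transpose = Q ∧ (X : Mat l) = ofComplex P Q := by
  obtain ⟨X, hX⟩ := X
  have h1 : X ∈ skewAdjointMatricesLieSubalgebra (Matrix.J (Fin l) ℝ) := hX.1
  have h2 : X ∈ LieAlgebra.Orthogonal.so (Fin l ⊕ Fin l) ℝ := hX.2
  rw [mem_skewAdjointMatricesLieSubalgebra, mem_skewAdjointMatricesSubmodule] at h1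
  rw [LieAlgebra.Orthogonal.mem_so] at h2
  rw [Matrix.IsSkewAdjoint, Matrix.IsAdjointPair, h2] at h1
  have hX' := Matrix.fromBlocks_toBlocks X
  rw [← hX'] at h1 h2
  simp only [Matrix.J, Matrix.fromBlocks_neg, Matrix.fromBlocks_multiply,
    Matrix.fromBlocks_transpose, Matrix.fromBlocks_inj] at h1 h2
  simp at h1
  refine ⟨X.toBlocks₁₁, X.toBlocks₂₁, h2.1, ?_, ?_⟩
  · rw [h2.2.1, h1.2.2.2]
  · change X = Matrix.fromBlocks _ _ _ _
    conv_lhs => rw [← hX', ← h1.2.1]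
    rw [← h1.1, neg_neg]

theorem sum_aux {l : ℕ} (P : Matrix (Fin l) (Fin l) ℝ) (c : ℝ) (a b : Fin l) :
    ∑ i, ∑ j, P i j * ((Matrix.single i j (1 : ℝ) a b) + c * Matrix.single j i (1 : ℝ) a b) =
      P a b + c * P b a := by
  simp only [mul_add, Finset.sum_add_distrib, Matrix.single_apply, ite_and]
  congr 1
  · simp
  · rw [Finset.sum_comm]
    simp [mul_comm]

theorem mem_sup {l d : ℕ} (X : kAlg l) : X ∈ mTheta l d ⊔ kTheta l d := by
  obtain ⟨P, Q, hP, hQ, hX⟩ := exists_ofComplex X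
  have key : (2 : ℝ) • X = ∑ i, ∑ j, (P i j • A i j + Q i j • S i j) := by
    apply Subtype.ext
    have hs : ((∑ i, ∑ j, (P i j • A i j + Q i j • S i j) : kAlg l) : Mat l) =
        ∑ i, ∑ j, (P i j • (A i j : Mat l) + Q i j • (S i j : Mat l)) := by
      push_cast
      rfl
    rw [hs]
    change (2 : ℝ) • (X : Mat l) = _
    rw [hX]
    have hP' : ∀ a b, P b a = -P a b := fun a b => congrFun (congrFun hP a) b
    have hQ' : ∀ a b, Q b a = Q a b := fun a b => congrFun (congrFun hQ a) b
    ext (a | a) (b | b) <;>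
      simp only [A, S, ofComplex, Matrix.smul_apply, Matrix.sum_apply, Matrix.add_apply,
        Matrix.sub_apply, Matrix.neg_apply, Matrix.zero_apply, Matrix.fromBlocks_apply₁₁,
        Matrix.fromBlocks_apply₁₂, Matrix.fromBlocks_apply₂₁, Matrix.fromBlocks_apply₂₂,
        smul_eq_mul, mul_zero, add_zero, zero_add, neg_zero, mul_neg, Finset.sum_neg_distrib]
    · have := sum_aux P (-1) a b
      simp only [neg_one_mul, ← sub_eq_add_neg] at this
      rw [this, hP' a b]; ring
    · have := sum_aux Q 1 a b
      simp only [one_mul] at this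
      rw [this, hQ' a b]; ring
    · have := sum_aux Q 1 a b
      simp only [one_mul] at this
      rw [this, hQ' a b]; ring
    · have := sum_aux P (-1) a b
      simp only [neg_one_mul, ← sub_eq_add_neg] at this
      rw [this, hP' a b]; ring
  have h2 : (2 : ℝ) • X ∈ mTheta l d ⊔ kTheta l d := by
    rw [key]
    exact sum_mem fun i _ => sum_mem fun j _ => add_mem
      (Submodule.smul_mem _ _ (A_mem_sup i j)) (Submodule.smul_mem _ _ (S_mem_sup i j))
  simpa using Submodule.smul_mem _ (2⁻¹ : ℝ) h2

theorem isCompl_mTheta_kTheta (l d : ℕ) : IsCompl (mTheta l d) (kTheta l d) := by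
  refine ⟨Submodule.disjoint_def.2 fun X hm hk => ?_,
    codisjoint_iff.2 (eq_top_iff.2 fun X _ => mem_sup X)⟩
  apply Subtype.ext
  ext a b
  by_cases h : (idx a).val < d ∨ (idx b).val < d
  · exact kTheta_le hk a b h
  · push Not at h
    exact mTheta_le hm a b h

theorem A_mem {l d : ℕ} {k j : Fin l} (hj : j.val < d) (hjk : j < k) : A k j ∈ mTheta l d := by
  refine Submodule.mem_iSup_of_mem (lam j - lam k) (Submodule.mem_iSup_of_mem ⟨Or.inl ⟨j, k, hjk, rfl⟩, fun h => ?_⟩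
    (A_mem_kRoot k j))
  have := eq_zero_of_mem_closure h.2 j hj
  simp [lam, hjk.ne] at this

theorem S_mem {l d : ℕ} {k j : Fin l} (hj : j.val < d) (hjk : j ≤ k) : S k j ∈ mTheta l d := by
  refine Submodule.mem_iSup_of_mem (lam j + lam k) (Submodule.mem_iSup_of_mem ⟨Or.inr ⟨j, k, hjk, rfl⟩, fun h => ?_⟩
    (S_mem_kRoot k j))
  have := eq_zero_of_mem_closure h.2 j hj
  by_cases e : j = k <;> simp [lam, e] at this

/-- The projection of `𝔨 = 𝔪_Θ ⊕ 𝔨_Θ` onto `𝔪_Θ`, written `X ↦ X_𝔪` below. -/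
noncomputable def projM (l d : ℕ) : kAlg l →ₗ[ℝ] mTheta l d :=
  (mTheta l d).projectionOnto (kTheta l d) (isCompl_mTheta_kTheta l d)

/-! ### Structures on `𝔪_Θ` -/

/-- `J` commutes with the isotropy representation of `K_Θ` on `𝔪_Θ`. -/
def KThetaInvariant {l d : ℕ} (J : Module.End ℝ (mTheta l d)) : Prop :=
  ∀ g : K l, (g : (Mat l)ˣ) ∈ KTheta l d →
    ∀ X Y : mTheta l d, (Y : kAlg l) = AdK g X → (J Y : kAlg l) = AdK g (J X)

/-- `N_J(X, Y) = [JX, JY]_𝔪 - [X, Y]_𝔪 - J [JX, Y]_𝔪 - J [X, JY]_𝔪`. -/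
noncomputable def nijenhuis {l d : ℕ} (J : Module.End ℝ (mTheta l d)) (X Y : mTheta l d) :
    mTheta l d :=
  projM l d ⁅(J X : kAlg l), (J Y : kAlg l)⁆ - projM l d ⁅(X : kAlg l), (Y : kAlg l)⁆
    - J (projM l d ⁅(J X : kAlg l), (Y : kAlg l)⁆) - J (projM l d ⁅(X : kAlg l), (J Y : kAlg l)⁆)

/-- `J` is integrable: its Nijenhuis tensor vanishes. -/
def Integrable {l d : ℕ} (J : Module.End ℝ (mTheta l d)) : Prop :=
  ∀ X Y : mTheta l d, nijenhuis J X Y = 0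

/-- `J² = -1`, `J` preserves `𝔨_{2λ_1} ⊕ ⋯ ⊕ 𝔨_{2λ_d}`, and `J A_{kj} = μ_{kj} S_{kj}`,
`J S_{kj} = -μ_{kj} A_{kj}` with `μ_{kj} = ±1` for all `1 ≤ j ≤ d`, `j < k ≤ l`. -/
structure IsStandard {l d : ℕ} (J : Module.End ℝ (mTheta l d)) (μ : Fin l → Fin l → ℝ) :
    Prop where
  sq : ∀ X, J (J X) = -X
  long : ∀ X : mTheta l d, (X : kAlg l) ∈ longPart l d → (J X : kAlg l) ∈ longPart l d
  sign : ∀ k j : Fin l, j.val < d → j < k → μ k j = 1 ∨ μ k j = -1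
  map_A : ∀ (k j : Fin l) (hj : j.val < d) (hjk : j < k),
    J ⟨A k j, A_mem hj hjk⟩ = μ k j • ⟨S k j, S_mem hj hjk.le⟩
  map_S : ∀ (k j : Fin l) (hj : j.val < d) (hjk : j < k),
    J ⟨S k j, S_mem hj hjk.le⟩ = -(μ k j • ⟨A k j, A_mem hj hjk⟩)

/-- For every `j ≤ d` the sign `μ_{kj}` does not depend on `k > d`, and for all `k > j > s` with
`j, s ≤ d` the triple `(μ_{ks}, μ_{kj}, μ_{js})` is `(a, a, a)`, `(a, -a, a)` or `(a, a, -a)`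
with `a = μ_{ks}`. -/
def SignCondition (l d : ℕ) (μ : Fin l → Fin l → ℝ) : Prop :=
  (∃ ε : Fin l → ℝ, (∀ j, ε j = 1 ∨ ε j = -1) ∧
    ∀ k j : Fin l, j.val < d → d ≤ k.val → μ k j = ε j) ∧
  ∀ k j s : Fin l, j.val < d → s.val < d → s < j → j < k →
    (μ k s, μ k j, μ j s) = (μ k s, μ k s, μ k s) ∨
    (μ k s, μ k j, μ j s) = (μ k s, -μ k s, μ k s) ∨
    (μ k s, μ k j, μ j s) = (μ k s, μ k s, -μ k s)

/-! ### Invariant structures on the flag manifold -/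

/-- The flag manifold `𝔽_Θ = K / K_Θ`, as the orbit of `𝔭_Θ` under `K`. -/
def Flag (l d : ℕ) : Type :=
  {q : Submodule ℝ (Mat l) // ∃ g ∈ K l, q = (parab l d).map (Ad g)}

/-- The origin of `𝔽_Θ`. -/
def Flag.origin (l d : ℕ) : Flag l d :=
  ⟨parab l d, 1, one_mem _, by rw [Ad_one, Submodule.map_id]⟩

/-- The Lie algebra `𝔨 ∩ 𝔮` of the stabilizer in `K` of the point `𝔮` of `𝔽_Θ`. -/
def isotropy {l d : ℕ} (q : Flag l d) : Submodule ℝ (kAlg l) :=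
  q.1.comap (kAlg l).toSubmodule.subtype

/-- The tangent space of `𝔽_Θ` at the point `𝔮`. The class of `X ∈ 𝔨` is the velocity at `t = 0`
of the curve `exp(tX) 𝔮`. -/
abbrev Tangent {l d : ℕ} (q : Flag l d) : Type := kAlg l ⧸ isotropy q

/-- The class of `X ∈ 𝔨` in the tangent space at `q`. -/
abbrev tangentClass {l d : ℕ} (q : Flag l d) (X : kAlg l) : Tangent q := (isotropy q).mkQ X

/-- A `K`-invariant almost complex structure on `𝔽_Θ`: a field `I` of complex structures on the
tangent spaces that commutes with the differential of the action of each `g ∈ K`, which takes the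
class of `X` at `q` to the class of `Ad(g) X` at `q' = g q`. (Invariant fields are smooth.) -/
structure IsInvariantAlmostComplex {l d : ℕ}
    (I : (q : Flag l d) → Module.End ℝ (Tangent q)) : Prop where
  sq : ∀ q v, I q (I q v) = -v
  inv : ∀ (g : K l) (q q' : Flag l d), q'.1 = q.1.map (Ad (g : (Mat l)ˣ)) →
    ∀ X Y : kAlg l, I q (tangentClass q X) = tangentClass q Y →
      I q' (tangentClass q' (AdK g X)) = tangentClass q' (AdK g Y)

/-- A `K`-invariant almost complex structure `I` is integrable: at each point its Nijenhuis tensor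
`[X', Y'] - [X, Y] - I [X', Y] - I [X, Y']` vanishes, where `X', Y' ∈ 𝔨` represent
`I X`, `I Y`. -/
def IsIntegrableField {l d : ℕ} (I : (q : Flag l d) → Module.End ℝ (Tangent q)) : Prop :=
  ∀ (q : Flag l d) (X Y X' Y' : kAlg l), I q (tangentClass q X) = tangentClass q X' →
    I q (tangentClass q Y) = tangentClass q Y' →
    tangentClass q ⁅X', Y'⁆ - tangentClass q ⁅X, Y⁆
      - I q (tangentClass q ⁅X', Y⁆) - I q (tangentClass q ⁅X, Y'⁆) = 0

/-- `I` is induced by `J`: at the origin, `I` corresponds to `J` under the identification of `𝔪_Θ`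
with the tangent space. -/
def IsInducedBy {l d : ℕ} (I : (q : Flag l d) → Module.End ℝ (Tangent q))
    (J : Module.End ℝ (mTheta l d)) : Prop :=
  ∀ X : mTheta l d,
    I (Flag.origin l d) (tangentClass _ (X : kAlg l)) = tangentClass _ (J X : kAlg l)

end FlagC

/-!
The identification of `fromBlocks A (-B) B A` with `A + i B` turns `𝔨` into the skew-Hermitian
matrices and `K` into `U(l)`. In this model `𝔪_Θ` consists of the skew-Hermitian matrices whose
lower right `(l - d) × (l - d)` block vanishes, and `K_Θ = {±1}^d × U(l - d)`: the algebra `𝔭_Θ`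
is the stabilizer in `𝔰𝔭(l, ℝ)` of an isotropic flag (`mem_parab_iff`), so an element of `K_Θ`
maps each of the first `d` basis vectors to a multiple of itself (`KTheta_col`), and elements of
`K` that preserve the blocks lie in `K_Θ` (`mem_KTheta_of_hgt`).

A standard `J` multiplies the entry `(a, b)`, `a ≠ b`, by `i ν_{ab}`, where `ν` is the
antisymmetric array of signs with `ν_{kj} = μ_{kj}` for `k > j` (`IsStandard.cx_apply`). Hence the
entry `(a, b)` of its Nijenhuis tensor is the sum over `c ≠ a, b` of `-(ν_{ab} - ν_{ac}) (ν_{ab} -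
ν_{cb}) (X_{ac} Y_{cb} - Y_{ac} X_{cb})`; the diagonal entries of `X` and `Y` do not contribute,
and the diagonal of the tensor vanishes (`IsStandard.cx_nijenhuis`,
`IsStandard.cx_nijenhuis_self`). So integrability is the condition on the triples
(`IsStandard.integrable_iff`). The group `K_Θ` acts trivially on the diagonal, by signs on the
other entries with both indices up to `d`, and by `U(l - d)` on the rest of each of the first `d`
rows, so invariance is the condition that the sign is constant along this rest
(`IsStandard.invariant`, `IsStandard.sign_const`).

Conversely, an invariant field is determined by an invariant `J` on `𝔪_Θ`, because the isotropy
algebra at the origin is `𝔨_Θ`. Commuting with the changes of sign of single coordinates, `J`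
preserves the diagonal part and each plane spanned by `A_{kj}` and `S_{kj}`. For diagonal `D` the
equations `N_J(D, A_{kj}) = 0` and `N_J(J D, A_{kj}) = 0` form a nondegenerate system as soon as
`[D, A_{kj}] ≠ 0`, and together with `J² = -1` it leaves only the two rotations by a right angle
on this plane (`Integrable.exists_sign`), so `J` is standard.
-/

namespace FlagC

open Matrix

/-! ### Real and complex matrices -/

/-- The complex matrix `A + i B` of which `fromBlocks A (-B) B A` is the real form; on other real
matrices only the first block column is read. -/
def toComplex {l : ℕ} : Mat l →ₗ[ℝ] Matrix (Fin l) (Fin l) ℂ where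
  toFun X := Matrix.of fun a b => ⟨X (.inl a) (.inl b), X (.inr a) (.inl b)⟩
  map_add' X Y := by ext; simp [Complex.ext_iff]
  map_smul' c X := by ext; simp [Complex.ext_iff]

/-- The real `2l × 2l` matrix of a complex matrix. -/
def realify {l : ℕ} (Z : Matrix (Fin l) (Fin l) ℂ) : Mat l :=
  ofComplex (Z.map Complex.re) (Z.map Complex.im)

theorem toComplex_apply {l : ℕ} (X : Mat l) (a b : Fin l) :
    toComplex X a b = ⟨X (.inl a) (.inl b), X (.inr a) (.inl b)⟩ := rfl

theorem toComplex_realify {l : ℕ} (Z : Matrix (Fin l) (Fin l) ℂ) :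
    toComplex (realify Z) = Z := by
  ext; simp [toComplex_apply, realify, ofComplex]

theorem realify_toComplex_ofComplex {l : ℕ} (P Q : Matrix (Fin l) (Fin l) ℝ) :
    realify (toComplex (ofComplex P Q)) = ofComplex P Q := by
  ext (a | a) (b | b) <;> simp [toComplex_apply, realify, ofComplex]

theorem realify_mul {l : ℕ} (Z W : Matrix (Fin l) (Fin l) ℂ) :
    realify (Z * W) = realify Z * realify W := by
  ext (a | a) (b | b) <;>
    simp [realify, ofComplex, Matrix.mul_apply, Finset.sum_add_distrib, Finset.sum_sub_distrib,
      Finset.sum_neg_distrib] <;> ring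

theorem realify_one {l : ℕ} : realify (1 : Matrix (Fin l) (Fin l) ℂ) = 1 := by
  ext (a | a) (b | b) <;> by_cases h : a = b <;> simp [realify, ofComplex, Matrix.one_apply, h]

theorem realify_conjTranspose {l : ℕ} (Z : Matrix (Fin l) (Fin l) ℂ) :
    realify Zᴴ = (realify Z)ᵀ := by
  ext (a | a) (b | b) <;> simp [realify, ofComplex]

theorem realify_I {l : ℕ} :
    realify (Complex.I • (1 : Matrix (Fin l) (Fin l) ℂ)) = Matrix.J (Fin l) ℝ := by
  ext (a | a) (b | b) <;> by_cases h : a = b <;>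
    simp [realify, ofComplex, Matrix.J, h]

theorem toComplex_realify_mul {l : ℕ} (Z : Matrix (Fin l) (Fin l) ℂ) (Y : Mat l) :
    toComplex (realify Z * Y) = Z * toComplex Y := by
  ext a b
  apply Complex.ext <;>
    simp [toComplex_apply, realify, ofComplex, Matrix.mul_apply, Finset.sum_add_distrib,
      Finset.sum_sub_distrib, Finset.sum_neg_distrib]
  · ring
  · ring

/-! ### The group `K` as the unitary group -/

theorem inv_eq_transpose_of_mem_K {l : ℕ} {g : (Mat l)ˣ} (hg : g ∈ K l) :
    ((g⁻¹ : (Mat l)ˣ) : Mat l) = (g : Mat l)ᵀ :=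
  Units.inv_eq_of_mul_eq_one_left
    ((Matrix.mem_orthogonalGroup_iff' _ _).1 ((Submonoid.mem_units_iff _ _).1 hg).1.2)

theorem mul_J_of_mem_K {l : ℕ} {g : (Mat l)ˣ} (hg : g ∈ K l) :
    (g : Mat l) * Matrix.J (Fin l) ℝ = Matrix.J (Fin l) ℝ * g := by
  have hJ : (g : Mat l) * Matrix.J (Fin l) ℝ * (g : Mat l)ᵀ = Matrix.J (Fin l) ℝ :=
    SymplecticGroup.mem_iff.1 ((Submonoid.mem_units_iff _ _).1 hg).1.1
  rw [← inv_eq_transpose_of_mem_K hg] at hJ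
  conv_rhs => rw [← hJ]
  rw [mul_assoc _ _ (g : Mat l), Units.inv_mul, mul_one]

/-- Orthogonal symplectic matrices are the real forms of unitary matrices. -/
theorem exists_unitary_of_mem_K {l : ℕ} {g : (Mat l)ˣ} (hg : g ∈ K l) :
    ∃ U : Matrix (Fin l) (Fin l) ℂ, (g : Mat l) = realify U ∧
      ((g⁻¹ : (Mat l)ˣ) : Mat l) = realify Uᴴ ∧ Uᴴ * U = 1 := by
  have hr : (g : Mat l) = realify (toComplex g) := by
    have hc := mul_J_of_mem_K hg
    have hX' := Matrix.fromBlocks_toBlocks (g : Mat l)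
    rw [← hX'] at hc
    simp only [Matrix.J, Matrix.fromBlocks_multiply, Matrix.fromBlocks_inj] at hc
    simp at hc
    have h : (g : Mat l) = ofComplex (g : Mat l).toBlocks₁₁ (g : Mat l).toBlocks₂₁ := by
      conv_lhs => rw [← hX']
      rw [ofComplex, hc.1, hc.2.1]
    rw [h, realify_toComplex_ofComplex]
  have hi : ((g⁻¹ : (Mat l)ˣ) : Mat l) = realify (toComplex g)ᴴ := by
    rw [inv_eq_transpose_of_mem_K hg, realify_conjTranspose, ← hr]
  refine ⟨toComplex g, hr, hi, ?_⟩
  have h1 := congrArg toComplex (g.inv_mul : ((g⁻¹ : (Mat l)ˣ) : Mat l) * g = 1)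
  rwa [hi, toComplex_realify_mul, ← realify_one, toComplex_realify] at h1

/-- The element of `K` with a given unitary matrix. -/
theorem exists_mem_K_of_unitary {l : ℕ} {U : Matrix (Fin l) (Fin l) ℂ} (hU : Uᴴ * U = 1) :
    ∃ g ∈ K l, (g : Mat l) = realify U ∧ ((g⁻¹ : (Mat l)ˣ) : Mat l) = realify Uᴴ := by
  have hU' : U * Uᴴ = 1 := mul_eq_one_comm.1 hU
  have key : ∀ V : Matrix (Fin l) (Fin l) ℂ, V * Vᴴ = 1 →
      realify V ∈ Matrix.symplecticGroup (Fin l) ℝ ⊓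
        Matrix.orthogonalGroup (Fin l ⊕ Fin l) ℝ := by
    intro V hV
    refine ⟨SymplecticGroup.mem_iff.2 ?_, (Matrix.mem_orthogonalGroup_iff _ _).2 ?_⟩
    · rw [← realify_I, ← realify_conjTranspose, ← realify_mul, ← realify_mul, mul_smul_comm,
        smul_mul_assoc, mul_one, hV]
    · change realify V * (realify V)ᵀ = 1
      rw [← realify_conjTranspose, ← realify_mul, hV, realify_one]
  refine ⟨⟨realify U, realify Uᴴ, ?_, ?_⟩, (Submonoid.mem_units_iff _ _).2 ⟨key U hU', ?_⟩,
    rfl, rfl⟩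
  · rw [← realify_mul, hU', realify_one]
  · rw [← realify_mul, hU, realify_one]
  · exact key Uᴴ (by rw [conjTranspose_conjTranspose, hU])

/-! ### The algebra `𝔨` as the skew-Hermitian matrices -/

/-- The isomorphism of `𝔨` with `𝔲(l)`. -/
noncomputable def cx {l : ℕ} : kAlg l →ₗ[ℝ] Matrix (Fin l) (Fin l) ℂ :=
  toComplex ∘ₗ (kAlg l).toSubmodule.subtype

theorem realify_cx {l : ℕ} (X : kAlg l) : realify (cx X) = X := by
  obtain ⟨P, Q, -, -, h⟩ := exists_ofComplex X
  change realify (toComplex (X : Mat l)) = X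
  rw [h, realify_toComplex_ofComplex]

theorem cx_injective {l : ℕ} {X Y : kAlg l} (h : ∀ a b, cx X a b = cx Y a b) : X = Y := by
  apply Subtype.ext
  rw [← realify_cx X, ← realify_cx Y, Matrix.ext h]

theorem cx_lie {l : ℕ} (X Y : kAlg l) : cx ⁅X, Y⁆ = cx X * cx Y - cx Y * cx X := by
  change toComplex ⁅(X : Mat l), (Y : Mat l)⁆ = _
  rw [Ring.lie_def, map_sub]
  conv_lhs => rw [← realify_cx X, ← realify_cx Y]
  rw [toComplex_realify_mul, toComplex_realify_mul, toComplex_realify, toComplex_realify]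

theorem cx_lie_apply {l : ℕ} (X Y : kAlg l) (a b : Fin l) :
    cx ⁅X, Y⁆ a b = ∑ c, (cx X a c * cx Y c b - cx Y a c * cx X c b) := by
  rw [cx_lie, Matrix.sub_apply, Matrix.mul_apply, Matrix.mul_apply, Finset.sum_sub_distrib]

theorem cx_skew {l : ℕ} (X : kAlg l) (a b : Fin l) : cx X b a = -star (cx X a b) := by
  obtain ⟨P, Q, hP, hQ, h⟩ := exists_ofComplex X
  have hP' : P b a = -P a b := congrFun (congrFun hP a) b
  have hQ' : Q b a = Q a b := congrFun (congrFun hQ a) b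
  change toComplex (X : Mat l) b a = -star (toComplex (X : Mat l) a b)
  rw [h]
  apply Complex.ext <;> simp [toComplex_apply, ofComplex, hP', hQ']

theorem cx_apply_eq_zero {l : ℕ} (X : kAlg l) {a b : Fin l}
    (h : ∀ p q : Fin l ⊕ Fin l, idx p = a → idx q = b → (X : Mat l) p q = 0) : cx X a b = 0 :=
  Complex.ext (h (.inl a) (.inl b) rfl rfl) (h (.inr a) (.inl b) rfl rfl)

theorem cx_A {l : ℕ} (k j a b : Fin l) :
    cx (A k j) a b = (Matrix.single k j (1 : ℂ) - Matrix.single j k 1 : Matrix _ _ ℂ) a b := by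
  change toComplex (ofComplex _ _) a b = _
  apply Complex.ext <;> simp only [toComplex_apply, ofComplex, Matrix.fromBlocks_apply₁₁,
    Matrix.fromBlocks_apply₂₁, Matrix.sub_apply, Matrix.zero_apply,
    Matrix.single_apply] <;> split_ifs <;> simp

theorem cx_S {l : ℕ} (k j a b : Fin l) :
    cx (S k j) a b =
      Complex.I * (Matrix.single k j (1 : ℂ) + Matrix.single j k 1 : Matrix _ _ ℂ) a b := by
  change toComplex (ofComplex _ _) a b = _
  apply Complex.ext <;> simp only [toComplex_apply, ofComplex, Matrix.fromBlocks_apply₁₁,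
    Matrix.fromBlocks_apply₂₁, Matrix.add_apply, Matrix.zero_apply,
    Matrix.single_apply] <;> split_ifs <;> simp

theorem cx_AdK {l : ℕ} (g : K l) {U : Matrix (Fin l) (Fin l) ℂ}
    (hg : ((g : (Mat l)ˣ) : Mat l) = realify U)
    (hg' : (((g : (Mat l)ˣ)⁻¹ : (Mat l)ˣ) : Mat l) = realify Uᴴ) (X : kAlg l) :
    cx (AdK g X) = U * cx X * Uᴴ := by
  change toComplex (((g : (Mat l)ˣ) : Mat l) * (X : Mat l) *
    (((g : (Mat l)ˣ)⁻¹ : (Mat l)ˣ) : Mat l)) = _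
  rw [hg, hg']
  conv_lhs => rw [← realify_cx X]
  rw [← realify_mul, ← realify_mul, toComplex_realify]

/-- `𝔨` is spanned by the `A_{ij}` and `S_{ij}`; the sum runs over ordered pairs, so every basis
vector occurs twice. -/
theorem two_smul_eq_sum {l : ℕ} (X : kAlg l) :
    (2 : ℝ) • X = ∑ i, ∑ j, ((cx X i j).re • A i j + (cx X i j).im • S i j) := by
  apply cx_injective
  intro a b
  have hs := cx_skew X b a
  simp only [map_sum, map_add, map_smul, Matrix.sum_apply, Matrix.add_apply, Matrix.smul_apply,
    cx_A, cx_S, Matrix.sub_apply, Matrix.single_apply, ite_and]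
  have h1 : ∀ f : Fin l → Fin l → ℂ,
      ∑ i, ∑ j, f i j * (if i = a then if j = b then 1 else 0 else 0) = f a b := by
    intro f; simp
  have h2 : ∀ f : Fin l → Fin l → ℂ,
      ∑ i, ∑ j, f i j * (if j = a then if i = b then 1 else 0 else 0) = f b a := by
    intro f; rw [Finset.sum_comm]; simp
  calc _ = (∑ i, ∑ j, (((cx X i j).re : ℂ) + (cx X i j).im * Complex.I) *
          (if i = a then if j = b then 1 else 0 else 0)) +
        ∑ i, ∑ j, (-((cx X i j).re : ℂ) + (cx X i j).im * Complex.I) *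
          (if j = a then if i = b then 1 else 0 else 0) := by
        rw [h1, h2, hs]
        apply Complex.ext <;> simp <;> ring
    _ = _ := by
        rw [← Finset.sum_add_distrib]
        refine Finset.sum_congr rfl fun i _ => ?_
        rw [← Finset.sum_add_distrib]
        refine Finset.sum_congr rfl fun j _ => ?_
        simp only [Complex.real_smul]
        ring

/-! ### Entries of the elements of `𝔪_Θ` and `𝔨_Θ` -/

theorem cx_eq_zero_of_mem_mTheta {l d : ℕ} {X : kAlg l} (hX : X ∈ mTheta l d) {a b : Fin l}
    (ha : d ≤ a.val) (hb : d ≤ b.val) : cx X a b = 0 :=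
  cx_apply_eq_zero X fun p q hp hq => mTheta_le hX p q ⟨hp ▸ ha, hq ▸ hb⟩

theorem cx_eq_zero_of_mem_kTheta {l d : ℕ} {X : kAlg l} (hX : X ∈ kTheta l d) {a b : Fin l}
    (h : a.val < d ∨ b.val < d) : cx X a b = 0 :=
  cx_apply_eq_zero X fun p q hp hq => kTheta_le hX p q (by subst hp hq; exact h)

theorem cx_eq_zero_of_mem_longPart {l d : ℕ} {X : kAlg l} (hX : X ∈ longPart l d) {a b : Fin l}
    (h : a ≠ b) : cx X a b = 0 := by
  have hle : longPart l d ≤ zeroOn (fun p q => idx p ≠ idx q) := by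
    refine iSup₂_le fun i _ => kRoot_le_zeroOn fun p q hpq => ?_
    have key : ∀ c : ℤ, c ≠ 0 → c • (lam i : Fin l → ℤ) ≠ wt p - wt q := by
      intro c hc e
      have hne : ∀ r : Fin l ⊕ Fin l, wt r (idx r) ≠ 0 := by
        rintro (r | r) <;> simp [wt, idx, lam]
      by_cases hp : idx p = i
      · have := congrFun e (idx q)
        have hq : idx q ≠ i := hp ▸ Ne.symm hpq
        rw [Pi.sub_apply, wt_eq_zero p _ (Ne.symm hpq)] at this
        simp [lam, hq, hne] at this
      · have := congrFun e (idx p)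
        rw [Pi.sub_apply, wt_eq_zero q _ hpq] at this
        simp [lam, hp, (hne p).symm] at this
    have h1 := key 2 (by norm_num)
    have h2 := key (-2) (by norm_num)
    rw [two_smul] at h1
    rw [neg_smul, two_smul] at h2
    exact ⟨h1, h2⟩
  exact cx_apply_eq_zero X fun p q hp hq => hle hX p q (by subst hp hq; exact h)

theorem cx_projM {l d : ℕ} (W : kAlg l) {a b : Fin l} (h : a.val < d ∨ b.val < d) :
    cx (projM l d W : kAlg l) a b = cx W a b := by
  have hk : W - projM l d W ∈ kTheta l d := by
    rw [← Submodule.projectionOnto_apply_eq_zero_iff (isCompl_mTheta_kTheta l d), map_sub,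
      Submodule.projectionOnto_apply_left, sub_eq_zero]
    rfl
  have := cx_eq_zero_of_mem_kTheta hk h
  rw [map_sub, Matrix.sub_apply, sub_eq_zero] at this
  exact this.symm

/-- Elements of `𝔪_Θ` are determined by the entries outside the lower right block. -/
theorem mTheta_ext {l d : ℕ} {X Y : mTheta l d}
    (h : ∀ a b : Fin l, a.val < d ∨ b.val < d → cx (X : kAlg l) a b = cx (Y : kAlg l) a b) :
    X = Y := by
  apply Subtype.ext
  apply cx_injective
  intro a b
  by_cases hab : a.val < d ∨ b.val < d
  · exact h a b hab
  · push Not at hab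
    rw [cx_eq_zero_of_mem_mTheta X.2 hab.1 hab.2, cx_eq_zero_of_mem_mTheta Y.2 hab.1 hab.2]

/-- The diagonal elements of `𝔪_Θ` make up `𝔨_{2λ_1} ⊕ ⋯ ⊕ 𝔨_{2λ_d}`. -/
theorem mem_longPart {l d : ℕ} (X : mTheta l d)
    (h : ∀ a b : Fin l, a ≠ b → cx (X : kAlg l) a b = 0) : (X : kAlg l) ∈ longPart l d := by
  have h2 : (2 : ℝ) • (X : kAlg l) ∈ longPart l d := by
    rw [two_smul_eq_sum]
    refine sum_mem fun i _ => sum_mem fun j _ => ?_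
    by_cases hij : i = j
    · subst hij
      by_cases hi : i.val < d
      · have hA : A i i = 0 := by
          apply cx_injective
          intro a b
          rw [cx_A]; simp
        rw [hA, smul_zero, zero_add]
        exact Submodule.smul_mem _ _ (Submodule.mem_iSup_of_mem i
          (Submodule.mem_iSup_of_mem hi (S_mem_kRoot i i)))
      · push Not at hi
        rw [cx_eq_zero_of_mem_mTheta X.2 hi hi]
        simp
    · rw [h i j hij]; simp
  simpa using Submodule.smul_mem _ (2⁻¹ : ℝ) h2

/-- The span of the `A_{kj}` and `S_{kj}` with `j ≤ d`, `j < k`: the part of `𝔪_Θ` that belongs to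
the short roots. -/
def shortPart (l d : ℕ) : Submodule ℝ (mTheta l d) :=
  Submodule.span ℝ {X | ∃ (k j : Fin l) (hj : j.val < d) (hjk : j < k),
    X = ⟨A k j, A_mem hj hjk⟩ ∨ X = ⟨S k j, S_mem hj hjk.le⟩}

theorem exists_long_short {l d : ℕ} (X : mTheta l d) :
    ∃ D Y : mTheta l d, (D : kAlg l) ∈ longPart l d ∧ Y ∈ shortPart l d ∧ X = D + Y := by
  have key : ∀ i j : Fin l, ∃ D Y : mTheta l d, (D : kAlg l) ∈ longPart l d ∧
      Y ∈ shortPart l d ∧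
      (cx (X : kAlg l) i j).re • A i j + (cx (X : kAlg l) i j).im • S i j =
        (D + Y : mTheta l d) := by
    intro i j
    rcases lt_trichotomy i j with h | rfl | h
    · by_cases hi : i.val < d
      · refine ⟨0, (-(cx (X : kAlg l) i j).re) • ⟨A j i, A_mem hi h⟩ +
          (cx (X : kAlg l) i j).im • ⟨S j i, S_mem hi h.le⟩, zero_mem _, add_mem
          (Submodule.smul_mem _ _ (Submodule.subset_span ⟨j, i, hi, h, Or.inl rfl⟩))
          (Submodule.smul_mem _ _ (Submodule.subset_span ⟨j, i, hi, h, Or.inr rfl⟩)), ?_⟩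
        rw [A_swap j i, S_swap j i]
        simp
      · push Not at hi
        refine ⟨0, 0, zero_mem _, zero_mem _, ?_⟩
        rw [cx_eq_zero_of_mem_mTheta X.2 hi (hi.trans h.le)]
        simp
    · by_cases hi : i.val < d
      · refine ⟨(cx (X : kAlg l) i i).im • ⟨S i i, S_mem hi le_rfl⟩, 0,
          Submodule.smul_mem _ _ (Submodule.mem_iSup_of_mem i
          (Submodule.mem_iSup_of_mem hi (S_mem_kRoot i i))), zero_mem _, ?_⟩
        have hA : A i i = 0 := by
          apply cx_injective
          intro a b
          rw [cx_A]; simp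
        simp [hA]
      · push Not at hi
        refine ⟨0, 0, zero_mem _, zero_mem _, ?_⟩
        rw [cx_eq_zero_of_mem_mTheta X.2 hi hi]
        simp
    · by_cases hj : j.val < d
      · refine ⟨0, (cx (X : kAlg l) i j).re • ⟨A i j, A_mem hj h⟩ +
          (cx (X : kAlg l) i j).im • ⟨S i j, S_mem hj h.le⟩, zero_mem _, add_mem
          (Submodule.smul_mem _ _ (Submodule.subset_span ⟨i, j, hj, h, Or.inl rfl⟩))
          (Submodule.smul_mem _ _ (Submodule.subset_span ⟨i, j, hj, h, Or.inr rfl⟩)), ?_⟩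
        simp
      · push Not at hj
        refine ⟨0, 0, zero_mem _, zero_mem _, ?_⟩
        rw [cx_eq_zero_of_mem_mTheta X.2 (hj.trans h.le) hj]
        simp
  choose D Y hD hY h using key
  refine ⟨(2⁻¹ : ℝ) • ∑ i, ∑ j, D i j, (2⁻¹ : ℝ) • ∑ i, ∑ j, Y i j, ?_,
    Submodule.smul_mem _ _ (sum_mem fun i _ => sum_mem fun j _ => hY i j), ?_⟩
  · simp only [Submodule.coe_smul, Submodule.coe_sum]
    exact Submodule.smul_mem _ _ (sum_mem fun i _ => sum_mem fun j _ => hD i j)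
  · apply Subtype.ext
    have h2 := two_smul_eq_sum (X : kAlg l)
    simp only [h] at h2
    rw [← smul_add, ← Finset.sum_add_distrib]
    simp only [← Finset.sum_add_distrib]
    simp only [Submodule.coe_smul, Submodule.coe_sum]
    rw [← h2, smul_smul]
    norm_num

/-! ### The parabolic subalgebra -/

theorem mem_sp_iff {l : ℕ} {X : Mat l} : X ∈ sp l ↔
    Xᵀ * Matrix.J (Fin l) ℝ = -(Matrix.J (Fin l) ℝ * X) := by
  change X ∈ skewAdjointMatricesLieSubalgebra (Matrix.J (Fin l) ℝ) ↔ _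
  rw [mem_skewAdjointMatricesLieSubalgebra, mem_skewAdjointMatricesSubmodule,
    Matrix.IsSkewAdjoint, Matrix.IsAdjointPair, mul_neg]

theorem mem_sp_iff_blocks {l : ℕ} {X : Mat l} : X ∈ sp l ↔
    X.toBlocks₂₁ᵀ = X.toBlocks₂₁ ∧ X.toBlocks₁₁ᵀ = -X.toBlocks₂₂ ∧
      X.toBlocks₁₂ᵀ = X.toBlocks₁₂ := by
  constructor
  · intro h
    rw [mem_sp_iff] at h
    rw [← Matrix.fromBlocks_toBlocks X] at h
    simp only [Matrix.J, Matrix.fromBlocks_neg, Matrix.fromBlocks_multiply,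
      Matrix.fromBlocks_transpose, Matrix.fromBlocks_inj] at h
    simp at h
    exact ⟨h.1, by rw [← h.2.1, neg_neg], h.2.2.2⟩
  · rintro ⟨h1, h2, h3⟩
    rw [← Matrix.fromBlocks_toBlocks X]
    exact fromBlocks_mem_sp h1 h2 h3

theorem Ad_mem_sp {l : ℕ} {g : (Mat l)ˣ} (hg : g ∈ K l) {X : Mat l} (hX : X ∈ sp l) :
    Ad g X ∈ sp l := by
  rw [mem_sp_iff] at hX ⊢
  have hi := inv_eq_transpose_of_mem_K hg
  have hJ := mul_J_of_mem_K hg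
  have hJ' := mul_J_of_mem_K (inv_mem hg)
  rw [hi] at hJ'
  change ((g : Mat l) * X * ((g⁻¹ : (Mat l)ˣ) : Mat l))ᵀ * _ =
    -(_ * ((g : Mat l) * X * ((g⁻¹ : (Mat l)ˣ) : Mat l)))
  rw [hi, Matrix.transpose_mul, Matrix.transpose_mul, Matrix.transpose_transpose, mul_assoc,
    mul_assoc, hJ', ← mul_assoc Xᵀ, hX, ← mul_assoc,
    ← mul_assoc (Matrix.J (Fin l) ℝ) _ (g : Mat l)ᵀ,
    ← mul_assoc (Matrix.J (Fin l) ℝ) (g : Mat l) X, ← hJ]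
  simp only [mul_assoc, mul_neg, neg_mul]

/-- The heights of the basis vectors of `ℝ^{2l}` in the isotropic flag `F_1 ⊂ ⋯ ⊂ F_d` stabilized
by `P_Θ`: the vectors of height at least `d + 1 - i` span `F_i`. -/
def hgt {l : ℕ} (d : ℕ) : Fin l ⊕ Fin l → ℤ :=
  Sum.elim (fun i => ((d - i.val : ℕ) : ℤ)) (fun i => -((d - i.val : ℕ) : ℤ))

theorem wt_dotProduct {l d : ℕ} (a : Fin l ⊕ Fin l) :
    wt a ⬝ᵥ (fun i : Fin l => ((d - i.val : ℕ) : ℤ)) = hgt d a := by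
  rcases a with a | a <;> simp [wt, lam, hgt]

theorem hgt_le_of_posRoots {l d : ℕ} {α : Fin l → ℤ} (hα : α ∈ posRoots l)
    {a b : Fin l ⊕ Fin l} (h : α = wt a - wt b) : hgt d b ≤ hgt d a := by
  rw [← sub_nonneg, ← wt_dotProduct, ← wt_dotProduct, ← sub_dotProduct, ← h]
  rcases hα with ⟨i, j, hij, rfl⟩ | ⟨i, j, -, rfl⟩
  · have : i.val < j.val := hij
    simp only [lam, sub_dotProduct, single_dotProduct, one_mul]
    omega
  · simp only [lam, add_dotProduct, single_dotProduct, one_mul]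
    omega

theorem hgt_eq_of_thetaPos {l d : ℕ} {α : Fin l → ℤ} (hα : α ∈ thetaPos l d)
    {a b : Fin l ⊕ Fin l} (h : -α = wt a - wt b) : hgt d b = hgt d a := by
  rw [← sub_eq_zero, ← neg_sub, neg_eq_zero, ← wt_dotProduct, ← wt_dotProduct, ← sub_dotProduct,
    ← h]
  refine Finset.sum_eq_zero fun i _ => ?_
  by_cases hi : i.val < d
  · rw [Pi.neg_apply, eq_zero_of_mem_closure hα.2 i hi, neg_zero, zero_mul]
  · simp [Nat.sub_eq_zero_of_le (not_lt.1 hi)]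

/-- The component of a matrix in the weight `α`. -/
def weightPart {l : ℕ} (α : Fin l → ℤ) (X : Mat l) : Mat l :=
  Matrix.of fun a b => if wt a - wt b = α then X a b else 0

theorem weightPart_mem {l : ℕ} (α : Fin l → ℤ) {X : Mat l} (hX : X ∈ sp l) :
    weightPart α X ∈ rootSpace α := by
  refine mem_rootSpace ?_ fun a b h => ?_
  · rw [mem_sp_iff_blocks] at hX ⊢
    obtain ⟨h1, h2, h3⟩ := hX
    refine ⟨?_, ?_, ?_⟩ <;> ext i j
    · have := congrFun (congrFun h1 i) j
      simp only [transpose_apply, toBlocks₂₁, of_apply] at this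
      simp only [toBlocks₂₁, weightPart, wt, Sum.elim_inl, Sum.elim_inr, transpose_apply,
        of_apply, this]
      exact if_congr (by rw [show -lam j - lam i = -lam i - lam j by abel]) rfl rfl
    · have := congrFun (congrFun h2 i) j
      simp only [transpose_apply, toBlocks₁₁, toBlocks₂₂, Matrix.neg_apply, of_apply] at this
      simp only [toBlocks₁₁, toBlocks₂₂, weightPart, wt, Sum.elim_inl, Sum.elim_inr,
        transpose_apply, Matrix.neg_apply, of_apply, this, neg_sub_neg]
      split_ifs <;> simp
    · have := congrFun (congrFun h3 i) j
      simp only [transpose_apply, toBlocks₁₂, of_apply] at this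
      simp [toBlocks₁₂, weightPart, wt, this, add_comm]
  · simp only [weightPart, of_apply] at h
    by_contra hc
    exact h (if_neg (Ne.symm hc))

theorem rootSpace_zero_le_cartan {l : ℕ} : rootSpace (0 : Fin l → ℤ) ≤ cartan l := by
  intro X hX
  have hd : ∀ a b, a ≠ b → X a b = 0 := by
    intro a b hab
    by_contra h
    exact hab (wt_eq_of a b (congrFun (sub_eq_zero.1 (entry_eq hX a b h).symm) _))
  have : X = cartanElt (fun i => X (.inl i) (.inl i)) := by
    have h2 := (mem_sp_iff_blocks.1 hX.1).2.1
    ext a b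
    by_cases hab : a = b
    · subst hab
      rcases a with a | a
      · simp [cartanElt]
      · have := congrFun (congrFun h2 a) a
        simp only [transpose_apply, toBlocks₁₁, toBlocks₂₂, Matrix.neg_apply, of_apply] at this
        simp [cartanElt, this]
    · rw [hd a b hab, cartanElt, Matrix.diagonal_apply_ne _ hab]
  rw [this]
  exact Submodule.subset_span ⟨_, rfl⟩

theorem rootSpace_le_parab {l d : ℕ} {a b : Fin l ⊕ Fin l} (h : hgt d b ≤ hgt d a) :
    rootSpace (wt a - wt b) ≤ parab l d := by
  have hpos : ∀ α ∈ posRoots l, rootSpace α ≤ parab l d := fun α hα =>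
    le_sup_of_le_left (le_sup_of_le_right (le_iSup₂_of_le α hα le_rfl))
  have hneg : ∀ α ∈ thetaPos l d, rootSpace (-α) ≤ parab l d := fun α hα =>
    le_sup_of_le_right (le_iSup₂_of_le α hα le_rfl)
  have hcar : cartan l ≤ parab l d := le_sup_of_le_left le_sup_left
  have hadd : ∀ i j : Fin l, lam i + lam j ∈ posRoots l := by
    intro i j
    rcases le_total i j with hij | hij
    · exact Or.inr ⟨i, j, hij, rfl⟩
    · exact Or.inr ⟨j, i, hij, add_comm _ _⟩
  have hsub : ∀ i j : Fin l, d - j.val ≤ d - i.val → rootSpace (lam i - lam j) ≤ parab l d := by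
    intro i j hij
    rcases lt_trichotomy i j with h | rfl | h
    · exact hpos _ (Or.inl ⟨i, j, h, rfl⟩)
    · rw [sub_self]
      exact rootSpace_zero_le_cartan.trans hcar
    · have h' : j.val < i.val := h
      rw [← neg_sub]
      exact hneg _ ⟨Or.inl ⟨j, i, h, rfl⟩, sub_mem_closure j i (by omega) h'.le⟩
  rcases a with i | i <;> rcases b with j | j <;>
    simp only [hgt, Sum.elim_inl, Sum.elim_inr] at h <;>
    simp only [wt, Sum.elim_inl, Sum.elim_inr]
  · exact hsub i j (by omega)
  · rw [sub_neg_eq_add]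
    exact hpos _ (hadd i j)
  · rw [← neg_add']
    exact hneg _ ⟨hadd i j, add_mem_closure i j (by omega) (by omega)⟩
  · rw [neg_sub_neg]
    exact hsub j i (by omega)

/-- `𝔭_Θ` consists of the elements of `𝔰𝔭(l, ℝ)` that do not lower the height, that is, of the
stabilizer of an isotropic flag. -/
theorem mem_parab_iff {l d : ℕ} {X : Mat l} :
    X ∈ parab l d ↔ X ∈ sp l ∧ ∀ a b, hgt d a < hgt d b → X a b = 0 := by
  constructor
  · let N : Submodule ℝ (Mat l) :=
      { carrier := {X | X ∈ sp l ∧ ∀ a b, hgt d a < hgt d b → X a b = 0}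
        zero_mem' := ⟨zero_mem _, fun _ _ _ => rfl⟩
        add_mem' := fun hX hY => ⟨add_mem hX.1 hY.1, fun a b h => by
          rw [Matrix.add_apply, hX.2 a b h, hY.2 a b h, add_zero]⟩
        smul_mem' := fun c X hX => ⟨(sp l).smul_mem c hX.1, fun a b h => by
          rw [Matrix.smul_apply, hX.2 a b h, smul_zero]⟩ }
    suffices parab l d ≤ N from fun h => this h
    refine sup_le (sup_le (Submodule.span_le.2 ?_) (iSup₂_le fun α hα Y hY => ⟨hY.1, ?_⟩))
      (iSup₂_le fun α hα Y hY => ⟨hY.1, ?_⟩)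
    · rintro _ ⟨h, rfl⟩
      refine ⟨mem_sp_iff_blocks.2 ?_, fun a b hab => ?_⟩
      · simp only [cartanElt, ← Matrix.fromBlocks_diagonal, toBlocks_fromBlocks₁₁,
          toBlocks_fromBlocks₁₂, toBlocks_fromBlocks₂₁, toBlocks_fromBlocks₂₂]
        refine ⟨by simp, ?_, by simp⟩
        ext i j
        by_cases hij : j = i
        · subst hij; simp
        · simp [Matrix.diagonal_apply_ne _ hij, Matrix.diagonal_apply_ne _ (Ne.symm hij)]
      · exact Matrix.diagonal_apply_ne _ fun e => by simp [e] at hab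
    · intro a b hab
      by_contra h
      exact hab.not_ge (hgt_le_of_posRoots hα (entry_eq hY a b h))
    · intro a b hab
      by_contra h
      exact hab.ne' (hgt_eq_of_thetaPos hα (entry_eq hY a b h))
  · rintro ⟨hX, h⟩
    have hsum : X = ∑ α ∈ Finset.univ.image
        (fun p : (Fin l ⊕ Fin l) × (Fin l ⊕ Fin l) => wt p.1 - wt p.2), weightPart α X := by
      ext a b
      rw [Matrix.sum_apply]
      simp only [weightPart, of_apply]
      rw [Finset.sum_ite_eq, if_pos (Finset.mem_image.2 ⟨(a, b), Finset.mem_univ _, rfl⟩)]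
    rw [hsum]
    refine sum_mem fun α _ => ?_
    by_cases hz : weightPart α X = 0
    · rw [hz]
      exact zero_mem _
    · obtain ⟨a, b, hab⟩ : ∃ a b, weightPart α X a b ≠ 0 := by
        by_contra! hc
        exact hz (Matrix.ext hc)
      have hmem := weightPart_mem α hX
      have hα := entry_eq hmem a b hab
      refine (hα ▸ rootSpace_le_parab (not_lt.1 fun hlt => hab ?_)) hmem
      simp only [weightPart, of_apply]
      rw [h a b hlt, ite_self]

/-! ### The isotropy group `K_Θ` -/

/-- Elements of `K` that preserve the height lie in `K_Θ`. -/
theorem mem_KTheta_of_hgt {l d : ℕ} {g : (Mat l)ˣ} (hg : g ∈ K l)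
    (h : ∀ a b, (g : Mat l) a b ≠ 0 → hgt d a = hgt d b) : g ∈ KTheta l d := by
  have key : ∀ g : (Mat l)ˣ, g ∈ K l → (∀ a b, (g : Mat l) a b ≠ 0 → hgt d a = hgt d b) →
      (parab l d).map (Ad g) ≤ parab l d := by
    rintro g hg h _ ⟨X, hX, rfl⟩
    rw [SetLike.mem_coe, mem_parab_iff] at hX
    refine mem_parab_iff.2 ⟨Ad_mem_sp hg hX.1, fun a b hab => ?_⟩
    change ((g : Mat l) * X * ((g⁻¹ : (Mat l)ˣ) : Mat l)) a b = 0
    rw [inv_eq_transpose_of_mem_K hg, Matrix.mul_apply]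
    refine Finset.sum_eq_zero fun c _ => ?_
    rw [Matrix.mul_apply, Matrix.transpose_apply, Finset.sum_mul]
    refine Finset.sum_eq_zero fun e _ => ?_
    by_contra hne
    have h1 := h a e (left_ne_zero_of_mul (left_ne_zero_of_mul hne))
    have h2 := h b c (right_ne_zero_of_mul hne)
    exact right_ne_zero_of_mul (left_ne_zero_of_mul hne) (hX.2 e c (by omega))
  refine ⟨hg, le_antisymm (key g hg h) ?_⟩
  have h2 := key g⁻¹ (inv_mem hg) fun a b hab => by
    rw [inv_eq_transpose_of_mem_K hg, Matrix.transpose_apply] at hab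
    exact (h b a hab).symm
  have h3 := Submodule.map_mono (f := Ad g) h2
  rwa [← Submodule.map_comp, ← Ad_mul, mul_inv_cancel, Ad_one, Submodule.map_id] at h3

/-- An element of `K_Θ` maps each of the first `d` basis vectors to a multiple of itself. For
`X ∈ 𝔭_Θ` the equation `X g = g X'` with `X' ∈ 𝔭_Θ` shows that the `i`-th column of `g` is an
eigenvector of `X` modulo the earlier basis vectors, and a root vector `X` with an entry at `(i, a)`
rules out a component of this column along the `a`-th basis vector. -/
theorem KTheta_col {l d : ℕ} {g : (Mat l)ˣ} (hg : g ∈ KTheta l d) (i : Fin l) (hi : i.val < d)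
    (a : Fin l ⊕ Fin l) (ha : a ≠ .inl i) : (g : Mat l) a (.inl i) = 0 := by
  induction i using WellFoundedLT.induction generalizing a with
  | ind i ih =>
  have hK := hg.1
  have hort : (g : Mat l)ᵀ * g = 1 := by
    rw [← inv_eq_transpose_of_mem_K hK, Units.inv_mul]
  -- the earlier columns are multiples of basis vectors, hence so are the corresponding rows
  have hrow : ∀ j : Fin l, j < i → ∀ c, c ≠ .inl j → (g : Mat l) (.inl j) c = 0 := by
    intro j hj c hc
    have hjd : j.val < d := lt_trans hj hi
    have hs : ∀ c, ((g : Mat l)ᵀ * g) (.inl j) c =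
        (g : Mat l) (.inl j) (.inl j) * (g : Mat l) (.inl j) c := by
      intro c
      rw [Matrix.mul_apply, Finset.sum_eq_single (.inl j)]
      · rfl
      · intro e _ he
        rw [Matrix.transpose_apply, ih j hj hjd e he, zero_mul]
      · simp
    have h1 := hs (.inl j)
    have h2 := hs c
    rw [hort, Matrix.one_apply_eq] at h1
    rw [hort, Matrix.one_apply_ne hc.symm] at h2
    exact (mul_eq_zero.1 h2.symm).resolve_left fun h0 => by simp [h0] at h1
  have hcol : ∀ X ∈ parab l d, ∃ x : ℝ, ∀ b, (∀ j, j < i → b ≠ .inl j) →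
      (X * g) b (.inl i) = (g : Mat l) b (.inl i) * x := by
    intro X hX
    have hX' : Ad g⁻¹ X ∈ parab l d := by
      rw [← (inv_mem hg).2]
      exact Submodule.mem_map_of_mem hX
    have he : X * g = g * Ad g⁻¹ X := by
      change X * g = g * (((g⁻¹ : (Mat l)ˣ) : Mat l) * X * ((g⁻¹⁻¹ : (Mat l)ˣ) : Mat l))
      rw [inv_inv, ← mul_assoc, ← mul_assoc, Units.mul_inv, one_mul]
    refine ⟨Ad g⁻¹ X (.inl i) (.inl i), fun b hb => ?_⟩
    rw [he, Matrix.mul_apply, Finset.sum_eq_single (.inl i)]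
    · intro c _ hc
      by_cases hh : hgt d c < hgt d (.inl i)
      · rw [(mem_parab_iff.1 hX').2 c _ hh, mul_zero]
      · rcases c with j | j
        · simp only [hgt, Sum.elim_inl] at hh
          have hne : j.val ≠ i.val := fun e => hc (by rw [Fin.ext e])
          have hj : j < i := Fin.lt_def.2 (by omega)
          rw [ih j hj (lt_trans hj hi) b (hb j hj), zero_mul]
        · simp only [hgt, Sum.elim_inl, Sum.elim_inr] at hh
          omega
    · simp
  have key : ∀ (c : ℝ) (X : Mat l), c ≠ 0 → X ∈ parab l d → (∀ j, j < i → a ≠ .inl j) →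
      (X * g) (.inl i) (.inl i) = c * (g : Mat l) a (.inl i) → (X * g) a (.inl i) = 0 →
      (g : Mat l) a (.inl i) = 0 := by
    intro c X hc hX haj h1 h2
    obtain ⟨x, hx⟩ := hcol X hX
    rw [hx a haj] at h2
    rw [hx _ fun j hj e => hj.ne (Sum.inl_injective e).symm] at h1
    rcases mul_eq_zero.1 h2 with h | h
    · exact h
    · rw [h, mul_zero] at h1
      exact (mul_eq_zero.1 h1.symm).resolve_left hc
  rcases a with k | k
  · have hki : k ≠ i := fun e => ha (by rw [e])
    rcases lt_or_gt_of_ne hki with h | h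
    · exact hrow k h _ fun e => hki (Sum.inl_injective e).symm
    · refine key 1 (Matrix.fromBlocks (Matrix.single i k 1) 0 0 (-Matrix.single k i 1))
        one_ne_zero (mem_parab_iff.2 ⟨fromBlocks_mem_sp (by simp) (by simp) (by simp), ?_⟩) ?_ ?_ ?_
      · have h' : i.val < k.val := h
        rintro (a | a) (b | b) hab
        · rw [Matrix.fromBlocks_apply₁₁, Matrix.single_apply_of_ne]
          rintro ⟨rfl, rfl⟩
          simp only [hgt, Sum.elim_inl] at hab
          omega
        · rfl
        · rfl
        · rw [Matrix.fromBlocks_apply₂₂, Matrix.neg_apply, Matrix.single_apply_of_ne, neg_zero]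
          rintro ⟨rfl, rfl⟩
          simp only [hgt, Sum.elim_inr] at hab
          omega
      · intro j hj e
        exact (hj.trans h).ne (Sum.inl_injective e).symm
      · simp [Matrix.mul_apply, Matrix.single_apply]
      · simp [Matrix.mul_apply, hki.symm]
  · refine key (if k = i then 2 else 1)
      (Matrix.fromBlocks 0 (Matrix.single i k 1 + Matrix.single k i 1) 0 0) (by split_ifs <;> simp)
      (mem_parab_iff.2 ⟨fromBlocks_mem_sp (by simp) (by simp) (by simp [add_comm]), ?_⟩)
      (by simp) ?_ ?_
    · rintro (a | a) (b | b) hab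
      · rfl
      · simp only [hgt, Sum.elim_inl, Sum.elim_inr] at hab
        omega
      · rfl
      · rfl
    · by_cases hki : k = i
      · subst hki
        simp [Matrix.mul_apply, Matrix.single_apply, add_mul, Finset.sum_add_distrib]
        ring
      · simp [Matrix.mul_apply, Matrix.single_apply, hki]
    · simp [Matrix.mul_apply]

/-- The unitary matrix of an element of `K_Θ` is in `{±1}^d × U(l - d)`. -/
theorem KTheta_unitary {l d : ℕ} {g : (Mat l)ˣ} (hg : g ∈ KTheta l d)
    {U : Matrix (Fin l) (Fin l) ℂ} (hU : (g : Mat l) = realify U) (hU1 : Uᴴ * U = 1)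
    {i : Fin l} (hi : i.val < d) :
    (U i i = 1 ∨ U i i = -1) ∧ ∀ c, c ≠ i → U c i = 0 ∧ U i c = 0 := by
  have hcol : ∀ c, c ≠ i → U c i = 0 := by
    intro c hc
    rw [← toComplex_realify U, ← hU]
    exact Complex.ext (KTheta_col hg i hi (.inl c) fun e => hc (Sum.inl_injective e))
      (KTheta_col hg i hi (.inr c) (by simp))
  have him : (U i i).im = 0 := by
    rw [← toComplex_realify U, ← hU]
    exact KTheta_col hg i hi (.inr i) (by simp)
  have hs : ∀ c, (Uᴴ * U) i c = U i i * U i c := by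
    intro c
    rw [Matrix.mul_apply, Finset.sum_eq_single i]
    · rw [Matrix.conjTranspose_apply, Complex.star_def, Complex.conj_eq_iff_im.2 him]
    · intro e _ he
      rw [Matrix.conjTranspose_apply, hcol e he, star_zero, zero_mul]
    · simp
  have h1 := hs i
  rw [hU1, Matrix.one_apply_eq] at h1
  refine ⟨mul_self_eq_one_iff.1 h1.symm, fun c hc => ⟨hcol c hc, ?_⟩⟩
  have h2 := hs c
  rw [hU1, Matrix.one_apply_ne hc.symm] at h2
  exact (mul_eq_zero.1 h2.symm).resolve_left fun h0 => by simp [h0] at h1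

/-! ### The entries of a standard structure -/

/-- The signs of a standard structure as an antisymmetric array: `μ_{ab}` for `b < a`, and
`-μ_{ba}` otherwise. -/
def antisymSign {l : ℕ} (μ : Fin l → Fin l → ℝ) (a b : Fin l) : ℝ :=
  if b < a then μ a b else -μ b a

theorem antisymSign_swap {l : ℕ} (μ : Fin l → Fin l → ℝ) {a b : Fin l} (h : a ≠ b) :
    antisymSign μ b a = -antisymSign μ a b := by
  rcases lt_or_gt_of_ne h with h | h <;> simp [antisymSign, h, h.not_gt]

theorem antisymSign_of_lt {l : ℕ} (μ : Fin l → Fin l → ℝ) {a b : Fin l} (h : b < a) :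
    antisymSign μ a b = μ a b := if_pos h

theorem antisymSign_of_gt {l : ℕ} (μ : Fin l → Fin l → ℝ) {a b : Fin l} (h : a < b) :
    antisymSign μ a b = -μ b a := if_neg h.not_gt

theorem cx_A_self {l : ℕ} (k j a : Fin l) : cx (A k j) a a = 0 := by
  rw [cx_A, Matrix.sub_apply, Matrix.single_apply, Matrix.single_apply, sub_eq_zero]
  exact if_congr and_comm rfl rfl

theorem cx_S_self {l : ℕ} {k j : Fin l} (h : j < k) (a : Fin l) : cx (S k j) a a = 0 := by
  rw [cx_S, Matrix.add_apply, Matrix.single_apply_of_ne, Matrix.single_apply_of_ne]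
  · simp
  · exact fun e => h.ne (e.1.trans e.2.symm)
  · exact fun e => h.ne (e.2.trans e.1.symm)

theorem cx_shortPart_self {l d : ℕ} {Y : mTheta l d} (hY : Y ∈ shortPart l d) (a : Fin l) :
    cx (Y : kAlg l) a a = 0 := by
  induction hY using Submodule.span_induction with
  | mem Y h =>
    obtain ⟨k, j, hj, hjk, rfl | rfl⟩ := h
    · exact cx_A_self k j a
    · exact cx_S_self hjk a
  | zero => simp
  | add Y Z _ _ hY hZ => simp [hY, hZ]
  | smul c Y _ hY => simp [hY]

section Standard

variable {l d : ℕ} {J : Module.End ℝ (mTheta l d)} {μ : Fin l → Fin l → ℝ}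

theorem IsStandard.map_shortPart (hJ : IsStandard J μ) {Y : mTheta l d}
    (hY : Y ∈ shortPart l d) : J Y ∈ shortPart l d := by
  induction hY using Submodule.span_induction with
  | mem Y h =>
    obtain ⟨k, j, hj, hjk, rfl | rfl⟩ := h
    · rw [hJ.map_A k j hj hjk]
      exact Submodule.smul_mem _ _ (Submodule.subset_span ⟨k, j, hj, hjk, Or.inr rfl⟩)
    · rw [hJ.map_S k j hj hjk]
      exact neg_mem (Submodule.smul_mem _ _ (Submodule.subset_span ⟨k, j, hj, hjk, Or.inl rfl⟩))
  | zero => simp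
  | add Y Z _ _ hY hZ => rw [map_add]; exact add_mem hY hZ
  | smul c Y _ hY => rw [map_smul]; exact Submodule.smul_mem _ _ hY

/-- A standard structure multiplies the entry `(a, b)` by `± i`. -/
theorem IsStandard.cx_apply (hJ : IsStandard J μ) (X : mTheta l d) {a b : Fin l} (hab : a ≠ b) :
    cx (J X : kAlg l) a b = Complex.I * antisymSign μ a b * cx (X : kAlg l) a b := by
  obtain ⟨D, Y, hD, hY, rfl⟩ := exists_long_short X
  have hDab := cx_eq_zero_of_mem_longPart hD hab
  have hJD := cx_eq_zero_of_mem_longPart (hJ.long D hD) hab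
  have key : cx (J Y : kAlg l) a b = Complex.I * antisymSign μ a b * cx (Y : kAlg l) a b := by
    induction hY using Submodule.span_induction with
    | mem Y h =>
      obtain ⟨k, j, hj, hjk, h⟩ := h
      have h1 : ∀ z : ℂ, (antisymSign μ a b : ℂ) * (Matrix.single k j z : Matrix _ _ ℂ) a b =
          μ k j * (Matrix.single k j z : Matrix _ _ ℂ) a b := by
        intro z
        by_cases e : k = a ∧ j = b
        · obtain ⟨rfl, rfl⟩ := e
          rw [antisymSign_of_lt μ hjk]
        · rw [Matrix.single_apply_of_ne (h := e), mul_zero, mul_zero]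
      have h2 : ∀ z : ℂ, (antisymSign μ a b : ℂ) * (Matrix.single j k z : Matrix _ _ ℂ) a b =
          -(μ k j * (Matrix.single j k z : Matrix _ _ ℂ) a b) := by
        intro z
        by_cases e : j = a ∧ k = b
        · obtain ⟨rfl, rfl⟩ := e
          rw [antisymSign_of_gt μ hjk]
          push_cast
          ring
        · rw [Matrix.single_apply_of_ne (h := e), mul_zero, mul_zero, neg_zero]
      rcases h with rfl | rfl
      · rw [hJ.map_A k j hj hjk, Submodule.coe_smul, map_smul, Matrix.smul_apply, cx_S, cx_A,
          Complex.real_smul, Matrix.sub_apply, Matrix.add_apply]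
        linear_combination -Complex.I * h1 1 + Complex.I * h2 1
      · rw [hJ.map_S k j hj hjk, Submodule.coe_neg, Submodule.coe_smul, map_neg, map_smul,
          Matrix.neg_apply, Matrix.smul_apply, cx_S, cx_A, Complex.real_smul, Matrix.sub_apply, Matrix.add_apply]
        linear_combination h1 1 + h2 1 -
          (antisymSign μ a b : ℂ) * ((Matrix.single k j 1 : Matrix _ _ ℂ) a b +
            (Matrix.single j k 1 : Matrix _ _ ℂ) a b) * Complex.I_mul_I
    | zero => simp
    | add Y Z _ _ hY hZ =>
      rw [map_add, Submodule.coe_add, Submodule.coe_add, map_add, map_add, Matrix.add_apply,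
        Matrix.add_apply, hY, hZ, mul_add]
    | smul c Y _ hY =>
      rw [map_smul, Submodule.coe_smul, Submodule.coe_smul, map_smul, map_smul, Matrix.smul_apply,
        Matrix.smul_apply, hY, mul_smul_comm]
  rw [map_add, Submodule.coe_add, Submodule.coe_add, map_add, map_add, Matrix.add_apply,
    Matrix.add_apply, hDab, hJD, zero_add, zero_add, key]

/-- A standard structure preserves the elements with zero diagonal. -/
theorem IsStandard.cx_self (hJ : IsStandard J μ) {X : mTheta l d}
    (hX : ∀ a, cx (X : kAlg l) a a = 0) (a : Fin l) : cx (J X : kAlg l) a a = 0 := by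
  obtain ⟨D, Y, hD, hY, rfl⟩ := exists_long_short X
  have hD0 : D = 0 := by
    apply Subtype.ext
    apply cx_injective
    intro a b
    by_cases hab : a = b
    · subst hab
      have := hX a
      rw [Submodule.coe_add, map_add, Matrix.add_apply, cx_shortPart_self hY, add_zero] at this
      simpa using this
    · simpa using cx_eq_zero_of_mem_longPart hD hab
  rw [hD0, zero_add]
  exact cx_shortPart_self (hJ.map_shortPart hY) a

theorem IsStandard.antisymSign_eq (hJ : IsStandard J μ) {a b : Fin l} (hab : a ≠ b)
    (h : a.val < d ∨ b.val < d) : antisymSign μ a b = 1 ∨ antisymSign μ a b = -1 := by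
  rcases lt_or_gt_of_ne hab with h' | h'
  · have h'' : a.val < b.val := h'
    rw [antisymSign_of_gt μ h']
    rcases hJ.sign b a (by omega) h' with e | e <;> simp [e]
  · have h'' : b.val < a.val := h'
    rw [antisymSign_of_lt μ h']
    exact hJ.sign a b (by omega) h'

theorem IsStandard.antisymSign_mul_self (hJ : IsStandard J μ) {a b : Fin l} (hab : a ≠ b)
    (h : a.val < d ∨ b.val < d) : (antisymSign μ a b : ℂ) * antisymSign μ a b = 1 := by
  rcases hJ.antisymSign_eq hab h with e | e <;> simp [e]

/-! ### The Nijenhuis tensor of a standard structure -/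

/-- The off-diagonal entries of the Nijenhuis tensor of a standard structure. The contributions of
the diagonal entries of `X` and `Y` cancel, whatever `J` does to them. -/
theorem IsStandard.cx_nijenhuis (hJ : IsStandard J μ) (X Y : mTheta l d) {a b : Fin l}
    (hab : a ≠ b) (h : a.val < d ∨ b.val < d) :
    cx (nijenhuis J X Y : kAlg l) a b = ∑ c, if c = a ∨ c = b then 0 else
      -((antisymSign μ a b - antisymSign μ a c : ℝ) * (antisymSign μ a b - antisymSign μ c b : ℝ) *
        (cx (X : kAlg l) a c * cx (Y : kAlg l) c b -
          cx (Y : kAlg l) a c * cx (X : kAlg l) c b) : ℂ) := by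
  have hs := hJ.antisymSign_mul_self hab h
  simp only [nijenhuis, Submodule.coe_sub, map_sub, Matrix.sub_apply, hJ.cx_apply _ hab,
    cx_projM _ h, cx_lie_apply, Finset.mul_sum, ← Finset.sum_sub_distrib]
  refine Finset.sum_congr rfl fun c _ => ?_
  split_ifs with hc
  · rcases hc with rfl | rfl
    · rw [hJ.cx_apply X hab, hJ.cx_apply Y hab]
      linear_combination (cx (Y : kAlg l) c c * cx (X : kAlg l) c b -
          cx (X : kAlg l) c c * cx (Y : kAlg l) c b) *
        ((antisymSign μ c b : ℂ) * antisymSign μ c b * Complex.I_mul_I - hs)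
    · rw [hJ.cx_apply X hab, hJ.cx_apply Y hab]
      linear_combination (cx (Y : kAlg l) a c * cx (X : kAlg l) c c -
          cx (X : kAlg l) a c * cx (Y : kAlg l) c c) *
        ((antisymSign μ a c : ℂ) * antisymSign μ a c * Complex.I_mul_I - hs)
  · push Not at hc
    rw [hJ.cx_apply X hc.1.symm, hJ.cx_apply Y hc.1.symm, hJ.cx_apply X hc.2, hJ.cx_apply Y hc.2]
    push_cast
    linear_combination (cx (X : kAlg l) a c * cx (Y : kAlg l) c b -
          cx (Y : kAlg l) a c * cx (X : kAlg l) c b) *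
        (((antisymSign μ a c : ℂ) * antisymSign μ c b -
          antisymSign μ a b * (antisymSign μ a c + antisymSign μ c b)) * Complex.I_mul_I + hs)

theorem IsStandard.cx_nijenhuis_self (hJ : IsStandard J μ) (X Y : mTheta l d) {a : Fin l}
    (h : a.val < d) : cx (nijenhuis J X Y : kAlg l) a a = 0 := by
  set W := projM l d ⁅(J X : kAlg l), (Y : kAlg l)⁆ + projM l d ⁅(X : kAlg l), (J Y : kAlg l)⁆
    with hW
  have hW0 : ∀ e, cx (W : kAlg l) e e = 0 := by
    intro e
    by_cases he : e.val < d
    · rw [hW, Submodule.coe_add, map_add, Matrix.add_apply, cx_projM _ (Or.inl he),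
        cx_projM _ (Or.inl he), cx_lie_apply, cx_lie_apply, ← Finset.sum_add_distrib]
      refine Finset.sum_eq_zero fun c _ => ?_
      by_cases hc : e = c
      · subst hc; ring
      · rw [hJ.cx_apply X hc, hJ.cx_apply Y hc, hJ.cx_apply X (Ne.symm hc),
          hJ.cx_apply Y (Ne.symm hc), antisymSign_swap μ hc]
        push_cast
        ring
    · push Not at he
      exact cx_eq_zero_of_mem_mTheta W.2 he he
  have hn : nijenhuis J X Y = projM l d ⁅(J X : kAlg l), (J Y : kAlg l)⁆ -
      projM l d ⁅(X : kAlg l), (Y : kAlg l)⁆ - J W := by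
    rw [hW, map_add, nijenhuis]
    abel
  rw [hn, Submodule.coe_sub, Submodule.coe_sub, map_sub, map_sub, Matrix.sub_apply,
    Matrix.sub_apply, hJ.cx_self hW0, cx_projM _ (Or.inl h), cx_projM _ (Or.inl h), cx_lie_apply,
    cx_lie_apply, sub_zero, ← Finset.sum_sub_distrib]
  refine Finset.sum_eq_zero fun c _ => ?_
  by_cases hc : a = c
  · subst hc; ring
  · have hs := hJ.antisymSign_mul_self hc (Or.inl h)
    rw [hJ.cx_apply X hc, hJ.cx_apply Y hc, hJ.cx_apply X (Ne.symm hc),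
      hJ.cx_apply Y (Ne.symm hc), antisymSign_swap μ hc]
    push_cast
    linear_combination (cx (X : kAlg l) a c * cx (Y : kAlg l) c a -
      cx (Y : kAlg l) a c * cx (X : kAlg l) c a) *
        (-(antisymSign μ a c : ℂ) * antisymSign μ a c * Complex.I_mul_I + hs)

/-- The only entry of the Nijenhuis tensor of `A_{kj}` and `A_{js}` that matters is the one at
`(k, s)`. -/
theorem IsStandard.sign_mul_eq_zero (hJ : IsStandard J μ) (hI : Integrable J) {k j s : Fin l}
    (hj : j.val < d) (hsd : s.val < d) (hsj : s < j) (hjk : j < k) :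
    (μ k s - μ k j) * (μ k s - μ j s) = 0 := by
  have hsk := hsj.trans hjk
  have h := hJ.cx_nijenhuis ⟨A k j, A_mem hj hjk⟩ ⟨A j s, A_mem hsd hsj⟩ hsk.ne' (Or.inr hsd)
  rw [hI, Finset.sum_eq_single j] at h
  · rw [if_neg (by simp [hjk.ne, hsj.ne'])] at h
    simp only [cx_A, Matrix.sub_apply, Matrix.single_apply, antisymSign_of_lt μ hsk,
      antisymSign_of_lt μ hsj, antisymSign_of_lt μ hjk] at h
    simp [hjk.ne, hjk.ne', hsj.ne, hsk.ne, hsj.ne'] at h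
    exact_mod_cast mul_eq_zero.2 h
  · intro c _ hc
    split_ifs
    · rfl
    · simp [cx_A, Matrix.single_apply, hc.symm, hjk.ne, hsk.ne]
  · simp

/-- The condition on triples in terms of the antisymmetric array: among the signs of `(a, c)` and
`(c, b)` one agrees with that of `(a, b)`. -/
theorem IsStandard.antisymSign_mul_eq_zero (hJ : IsStandard J μ)
    (hS : ∀ k j s : Fin l, j.val < d → s.val < d → s < j → j < k →
      μ k s = μ k j ∨ μ k s = μ j s)
    {a b c : Fin l} (hab : a ≠ b) (hac : a ≠ c) (hcb : c ≠ b) (h1 : a.val < d ∨ b.val < d)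
    (h2 : a.val < d ∨ c.val < d) (h3 : c.val < d ∨ b.val < d) :
    (antisymSign μ a b - antisymSign μ a c) * (antisymSign μ a b - antisymSign μ c b) = 0 := by
  have key : ∀ k j s : Fin l, j.val < d → s.val < d → s < j → j < k →
      ∃ p q r : ℝ, μ k s = p ∧ μ k j = q ∧ μ j s = r ∧ (p = 1 ∨ p = -1) ∧ (q = 1 ∨ q = -1) ∧
        (r = 1 ∨ r = -1) ∧ (p = q ∨ p = r) := fun k j s hj hs hsj hjk =>
    ⟨_, _, _, rfl, rfl, rfl, hJ.sign k s hs (hsj.trans hjk), hJ.sign k j hj hjk,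
      hJ.sign j s hs hsj, hS k j s hj hs hsj hjk⟩
  have lt_val : ∀ {x y : Fin l}, x < y → x.val < y.val := fun h => h
  rcases lt_or_gt_of_ne hab with hab | hab <;> rcases lt_or_gt_of_ne hac with hac | hac <;>
    rcases lt_or_gt_of_ne hcb with hcb | hcb <;>
    first
    | (have := lt_val hab; have := lt_val hac; have := lt_val hcb; omega)
    | skip
  all_goals
    have ha := lt_val hab
    have hb := lt_val hac
    have hc := lt_val hcb
    simp only [antisymSign, hab, hac, hcb, hab.not_gt, hac.not_gt, hcb.not_gt, if_true, if_false]
  · obtain ⟨p, q, r, e1, e2, e3, hp, hq, hr, h⟩ := key b c a (by omega) (by omega) hac hcb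
    rw [e1, e2, e3]
    rcases h with rfl | rfl <;> ring
  · obtain ⟨p, q, r, e1, e2, e3, hp, hq, hr, h⟩ := key c b a (by omega) (by omega) hab hcb
    rw [e1, e2, e3]
    rcases hp with rfl | rfl <;> rcases hq with rfl | rfl <;> rcases hr with rfl | rfl <;>
      first | (exfalso; norm_num at h; done) | norm_num
  · obtain ⟨p, q, r, e1, e2, e3, hp, hq, hr, h⟩ := key b a c (by omega) (by omega) hac hab
    rw [e1, e2, e3]
    rcases hp with rfl | rfl <;> rcases hq with rfl | rfl <;> rcases hr with rfl | rfl <;>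
      first | (exfalso; norm_num at h; done) | norm_num
  · obtain ⟨p, q, r, e1, e2, e3, hp, hq, hr, h⟩ := key c a b (by omega) (by omega) hab hac
    rw [e1, e2, e3]
    rcases hp with rfl | rfl <;> rcases hq with rfl | rfl <;> rcases hr with rfl | rfl <;>
      first | (exfalso; norm_num at h; done) | norm_num
  · obtain ⟨p, q, r, e1, e2, e3, hp, hq, hr, h⟩ := key a b c (by omega) (by omega) hcb hab
    rw [e1, e2, e3]
    rcases hp with rfl | rfl <;> rcases hq with rfl | rfl <;> rcases hr with rfl | rfl <;>
      first | (exfalso; norm_num at h; done) | norm_num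
  · obtain ⟨p, q, r, e1, e2, e3, hp, hq, hr, h⟩ := key a c b (by omega) (by omega) hcb hac
    rw [e1, e2, e3]
    rcases h with rfl | rfl <;> ring

/-- A standard structure is integrable exactly if in each triangle `s < j < k` of short roots the
sign of `(k, s)` agrees with one of the other two. -/
theorem IsStandard.integrable_iff (hJ : IsStandard J μ) : Integrable J ↔
    ∀ k j s : Fin l, j.val < d → s.val < d → s < j → j < k → μ k s = μ k j ∨ μ k s = μ j s := by
  constructor
  · intro hI k j s hj hs hsj hjk
    rcases mul_eq_zero.1 (hJ.sign_mul_eq_zero hI hj hs hsj hjk) with h | h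
    · exact Or.inl (sub_eq_zero.1 h)
    · exact Or.inr (sub_eq_zero.1 h)
  · intro hS X Y
    refine mTheta_ext fun a b h => ?_
    rw [Submodule.coe_zero, map_zero, Matrix.zero_apply]
    by_cases hab : a = b
    · subst hab
      exact hJ.cx_nijenhuis_self X Y (h.elim id id)
    rw [hJ.cx_nijenhuis X Y hab h]
    refine Finset.sum_eq_zero fun c _ => ?_
    split_ifs with hc
    · rfl
    push Not at hc
    by_cases h2 : a.val < d ∨ c.val < d
    · by_cases h3 : c.val < d ∨ b.val < d
      · rw [← Complex.ofReal_mul,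
          hJ.antisymSign_mul_eq_zero hS hab hc.1.symm hc.2 h h2 h3]
        simp
      · push Not at h3
        rw [cx_eq_zero_of_mem_mTheta X.2 h3.1 h3.2, cx_eq_zero_of_mem_mTheta Y.2 h3.1 h3.2]
        simp
    · push Not at h2
      rw [cx_eq_zero_of_mem_mTheta X.2 h2.1 h2.2, cx_eq_zero_of_mem_mTheta Y.2 h2.1 h2.2]
      simp

theorem IsStandard.signTriple_iff (hJ : IsStandard J μ) {k j s : Fin l} (hj : j.val < d)
    (hs : s.val < d) (hsj : s < j) (hjk : j < k) :
    ((μ k s, μ k j, μ j s) = (μ k s, μ k s, μ k s) ∨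
      (μ k s, μ k j, μ j s) = (μ k s, -μ k s, μ k s) ∨
      (μ k s, μ k j, μ j s) = (μ k s, μ k s, -μ k s)) ↔ (μ k s = μ k j ∨ μ k s = μ j s) := by
  simp only [Prod.mk.injEq, true_and]
  rcases hJ.sign k s hs (hsj.trans hjk) with e | e <;> rcases hJ.sign k j hj hjk with e' | e' <;>
    rcases hJ.sign j s hs hsj with e'' | e'' <;> rw [e, e', e''] <;> norm_num

/-! ### Invariance of a standard structure -/

theorem exists_mem_KTheta {U : Matrix (Fin l) (Fin l) ℂ} (hU : Uᴴ * U = 1)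
    (h : ∀ a b, U a b ≠ 0 → (a = b ∧ (U a b).im = 0) ∨ (d ≤ a.val ∧ d ≤ b.val)) :
    ∃ g ∈ KTheta l d, (g : Mat l) = realify U ∧ ((g⁻¹ : (Mat l)ˣ) : Mat l) = realify Uᴴ := by
  obtain ⟨g, hg, h1, h2⟩ := exists_mem_K_of_unitary hU
  refine ⟨g, mem_KTheta_of_hgt hg ?_, h1, h2⟩
  have hzero : ∀ a b : Fin l, d ≤ a.val ∧ d ≤ b.val → d - a.val = 0 ∧ d - b.val = 0 := by
    intro a b h
    omega
  rintro (a | a) (b | b) hab <;> simp only [h1, realify, ofComplex, Matrix.fromBlocks_apply₁₁,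
    Matrix.fromBlocks_apply₁₂, Matrix.fromBlocks_apply₂₁, Matrix.fromBlocks_apply₂₂,
    Matrix.map_apply, Matrix.neg_apply, ne_eq, neg_eq_zero] at hab <;>
    rcases h a b (fun e => hab (by simp [e])) with ⟨rfl, him⟩ | hd <;>
    first
    | rfl
    | exact absurd him hab
    | simp [hgt, hzero _ _ hd]

/-- Invariance in terms of unitary matrices in `{±1}^d × U(l - d)`. -/
theorem KThetaInvariant.cx_conj (hJ : KThetaInvariant J) {U : Matrix (Fin l) (Fin l) ℂ}
    (hU : Uᴴ * U = 1)
    (h : ∀ a b, U a b ≠ 0 → (a = b ∧ (U a b).im = 0) ∨ (d ≤ a.val ∧ d ≤ b.val))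
    {X Y : mTheta l d} (hXY : cx (Y : kAlg l) = U * cx (X : kAlg l) * Uᴴ) :
    cx (J Y : kAlg l) = U * cx (J X : kAlg l) * Uᴴ := by
  obtain ⟨g, hg, h1, h2⟩ := exists_mem_KTheta hU h
  have hY : (Y : kAlg l) = AdK ⟨g, hg.1⟩ X := by
    apply cx_injective
    intro a b
    rw [cx_AdK ⟨g, hg.1⟩ h1 h2, hXY]
  rw [hJ ⟨g, hg.1⟩ hg X Y hY, cx_AdK ⟨g, hg.1⟩ h1 h2]

/-- An invariant structure commutes with the transpositions of indices beyond `d`. -/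
theorem KThetaInvariant.cx_swap (hJ : KThetaInvariant J) {k k' : Fin l} (hk : d ≤ k.val)
    (hk' : d ≤ k'.val) {X Y : mTheta l d}
    (hXY : ∀ a b, cx (Y : kAlg l) a b =
      cx (X : kAlg l) (Equiv.swap k k' a) (Equiv.swap k k' b)) (a b : Fin l) :
    cx (J Y : kAlg l) a b = cx (J X : kAlg l) (Equiv.swap k k' a) (Equiv.swap k k' b) := by
  set U : Matrix (Fin l) (Fin l) ℂ := (1 : Matrix (Fin l) (Fin l) ℂ).submatrix (Equiv.swap k k') id
    with hU
  have hconj : ∀ (Z : Matrix (Fin l) (Fin l) ℂ) a b,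
      (U * Z * Uᴴ) a b = Z (Equiv.swap k k' a) (Equiv.swap k k' b) := by
    intro Z a b
    simp [hU, Matrix.mul_apply, Matrix.one_apply, apply_ite]
  have hU1 : Uᴴ * U = 1 := by
    rw [mul_eq_one_comm]
    ext a b
    have := hconj 1 a b
    rw [mul_one] at this
    rw [this]
    simp [Matrix.one_apply]
  rw [hJ.cx_conj hU1 ?_ (Matrix.ext fun a b => (hXY a b).trans (hconj _ a b).symm), hconj]
  intro a b hab
  simp only [hU, Matrix.submatrix_apply, id, Matrix.one_apply] at hab ⊢
  have e : Equiv.swap k k' a = b := by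
    by_contra hc
    exact hab (if_neg hc)
  rw [if_pos e]
  by_cases ha : a = k
  · subst ha
    rw [Equiv.swap_apply_left] at e
    exact Or.inr ⟨hk, e ▸ hk'⟩
  · by_cases ha' : a = k'
    · subst ha'
      rw [Equiv.swap_apply_right] at e
      exact Or.inr ⟨hk', e ▸ hk⟩
    · rw [Equiv.swap_apply_of_ne_of_ne ha ha'] at e
      exact Or.inl ⟨e, Complex.one_im⟩

/-- An invariant structure commutes with the change of sign of the `i`-th coordinate. -/
theorem KThetaInvariant.cx_flip (hJ : KThetaInvariant J) (i : Fin l) {X Y : mTheta l d}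
    (hXY : ∀ a b, cx (Y : kAlg l) a b =
      (if a = i then -1 else 1) * cx (X : kAlg l) a b * (if b = i then -1 else 1)) (a b : Fin l) :
    cx (J Y : kAlg l) a b =
      (if a = i then -1 else 1) * cx (J X : kAlg l) a b * (if b = i then -1 else 1) := by
  set U : Matrix (Fin l) (Fin l) ℂ := Matrix.diagonal fun a => if a = i then -1 else 1 with hU
  have hH : Uᴴ = U := by
    rw [hU, Matrix.diagonal_conjTranspose]
    congr 1
    ext a
    simp only [Pi.star_apply]
    split_ifs <;> simp
  have hconj : ∀ (Z : Matrix (Fin l) (Fin l) ℂ) a b,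
      (U * Z * Uᴴ) a b = (if a = i then -1 else 1) * Z a b * (if b = i then -1 else 1) := by
    intro Z a b
    rw [hH, hU, Matrix.mul_diagonal, Matrix.diagonal_mul]
  have hU1 : Uᴴ * U = 1 := by
    rw [hH, hU, Matrix.diagonal_mul_diagonal, ← Matrix.diagonal_one]
    congr 1
    ext a
    split_ifs <;> simp
  rw [hJ.cx_conj hU1 ?_ (Matrix.ext fun a b => (hXY a b).trans (hconj _ a b).symm), hconj]
  intro a b hab
  have e : a = b := by
    by_contra hc
    exact hab (Matrix.diagonal_apply_ne _ hc)
  subst e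
  refine Or.inl ⟨rfl, ?_⟩
  rw [hU, Matrix.diagonal_apply_eq]
  split_ifs <;> simp

theorem IsStandard.sign_const (hJ : IsStandard J μ) (hK : KThetaInvariant J) {k k' j : Fin l}
    (hj : j.val < d) (hk : d ≤ k.val) (hk' : d ≤ k'.val) : μ k' j = μ k j := by
  have hjk : j < k := Fin.lt_def.2 (by omega)
  have hjk' : j < k' := Fin.lt_def.2 (by omega)
  have e1 : ∀ a, k = Equiv.swap k k' a ↔ k' = a := by
    intro a
    rw [eq_comm, Equiv.swap_apply_eq_iff, Equiv.swap_apply_left, eq_comm]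
  have e2 : ∀ a, j = Equiv.swap k k' a ↔ j = a := by
    intro a
    rw [eq_comm, Equiv.swap_apply_eq_iff, Equiv.swap_apply_of_ne_of_ne hjk.ne hjk'.ne, eq_comm]
  have h := hK.cx_swap hk hk' (X := ⟨A k j, A_mem hj hjk⟩) (Y := ⟨A k' j, A_mem hj hjk'⟩)
    (fun a b => by simp only [cx_A, Matrix.sub_apply, Matrix.single_apply, e1, e2]) k' j
  rw [Equiv.swap_apply_right, Equiv.swap_apply_of_ne_of_ne hjk.ne hjk'.ne, hJ.cx_apply _ hjk.ne',
    hJ.cx_apply _ hjk'.ne', antisymSign_of_lt μ hjk, antisymSign_of_lt μ hjk', cx_A, cx_A] at h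
  simpa [Matrix.single_apply, hjk.ne, hjk'.ne] using h

/-- `𝔪_Θ` consists of the elements of `𝔨` whose lower right block vanishes. -/
theorem mem_mTheta_iff {X : kAlg l} :
    X ∈ mTheta l d ↔ ∀ a b : Fin l, d ≤ a.val → d ≤ b.val → cx X a b = 0 := by
  refine ⟨fun h a b ha hb => cx_eq_zero_of_mem_mTheta h ha hb, fun h => ?_⟩
  have : X = projM l d X := by
    apply cx_injective
    intro a b
    by_cases hab : a.val < d ∨ b.val < d
    · rw [cx_projM X hab]
    · push Not at hab
      rw [h a b hab.1 hab.2, cx_eq_zero_of_mem_mTheta (projM l d X).2 hab.1 hab.2]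
  rw [this]
  exact (projM l d X).2

theorem AdK_mem_mTheta {g : K l} (hg : (g : (Mat l)ˣ) ∈ KTheta l d) {X : kAlg l}
    (hX : X ∈ mTheta l d) : AdK g X ∈ mTheta l d := by
  obtain ⟨U, h1, h2, hU⟩ := exists_unitary_of_mem_K g.2
  have hcol : ∀ a : Fin l, a.val < d → ∀ c, c ≠ a → U c a = 0 := fun a ha c hc =>
    ((KTheta_unitary hg h1 hU ha).2 c hc).1
  refine mem_mTheta_iff.2 fun a b ha hb => ?_
  rw [cx_AdK g h1 h2, Matrix.mul_apply]
  refine Finset.sum_eq_zero fun e _ => ?_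
  rw [Matrix.mul_apply, Finset.sum_mul]
  refine Finset.sum_eq_zero fun c _ => ?_
  by_cases hc : c.val < d
  · rw [hcol c hc a fun h => by subst h; omega, zero_mul, zero_mul]
  by_cases he : e.val < d
  · rw [Matrix.conjTranspose_apply, hcol e he b fun h => by subst h; omega, star_zero, mul_zero]
  · push Not at hc he
    rw [cx_eq_zero_of_mem_mTheta hX hc he, mul_zero, zero_mul]

/-- If for each `j ≤ d` the sign of `(k, j)` is the same for all `k > d`, then `J` is invariant:
`K_Θ` acts by signs on the first `d` coordinates and complex linearly on the others, and on the part
of the `j`-th row beyond `d` the structure `J` is multiplication by `i` or by `-i`. -/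
theorem IsStandard.invariant (hJ : IsStandard J μ)
    (hS : ∀ k k' j : Fin l, j.val < d → d ≤ k.val → d ≤ k'.val → μ k' j = μ k j) :
    KThetaInvariant J := by
  intro g hg X Y hY
  obtain ⟨U, h1, h2, hU⟩ := exists_unitary_of_mem_K g.2
  have hrow : ∀ a : Fin l, a.val < d → ∀ c, c ≠ a → U c a = 0 ∧ U a c = 0 := fun a ha =>
    (KTheta_unitary hg h1 hU ha).2
  have hdiag : ∀ a : Fin l, a.val < d → U a a * star (U a a) = 1 := by
    intro a ha
    rcases (KTheta_unitary hg h1 hU ha).1 with e | e <;> simp [e]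
  have hconj : ∀ Z : kAlg l, ∀ a : Fin l, a.val < d → ∀ b,
      cx (AdK g Z) a b = U a a * ∑ e, cx Z a e * star (U b e) := by
    intro Z a ha b
    rw [cx_AdK g h1 h2, Matrix.mul_apply, Finset.mul_sum]
    refine Finset.sum_congr rfl fun e _ => ?_
    rw [Matrix.mul_apply, Finset.sum_eq_single a, Matrix.conjTranspose_apply, mul_assoc]
    · intro c _ hc
      rw [(hrow a ha c hc).2, zero_mul]
    · simp
  have hconj' : ∀ Z : kAlg l, ∀ a b : Fin l, a.val < d → b.val < d →
      cx (AdK g Z) a b = U a a * (cx Z a b * star (U b b)) := by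
    intro Z a b ha hb
    rw [hconj Z a ha, Finset.sum_eq_single b]
    · intro c _ hc
      rw [(hrow b hb c hc).2, star_zero, mul_zero]
    · simp
  have hself : ∀ Z : kAlg l, ∀ a : Fin l, a.val < d → cx (AdK g Z) a a = cx Z a a := by
    intro Z a ha
    rw [hconj' Z a a ha ha, mul_left_comm, hdiag a ha, mul_one]
  have key : ∀ a b : Fin l, a.val < d → cx (J Y : kAlg l) a b = cx (AdK g (J X)) a b := by
    intro a b ha
    by_cases hab : a = b
    · subst hab
      rw [hself _ a ha]
      have hz := hJ.cx_self (X := Y - X) (fun e => by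
        by_cases he : e.val < d
        · rw [Submodule.coe_sub, map_sub, Matrix.sub_apply, hY, hself _ e he, sub_self]
        · push Not at he
          exact cx_eq_zero_of_mem_mTheta (Y - X).2 he he) a
      rw [map_sub, Submodule.coe_sub, map_sub, Matrix.sub_apply, sub_eq_zero] at hz
      exact hz
    rw [hJ.cx_apply Y hab, hY]
    by_cases hb : b.val < d
    · rw [hconj' _ a b ha hb, hconj' _ a b ha hb, hJ.cx_apply X hab]
      ring
    · push Not at hb
      rw [hconj _ a ha, hconj _ a ha, mul_left_comm, Finset.mul_sum]
      congr 1
      refine Finset.sum_congr rfl fun e _ => ?_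
      by_cases he : e.val < d
      · have hbe : b ≠ e := fun h => by subst h; omega
        rw [(hrow e he b hbe).1, star_zero, mul_zero, mul_zero, mul_zero]
      · push Not at he
        have hae : a < e := Fin.lt_def.2 (by omega)
        have hab' : a < b := Fin.lt_def.2 (by omega)
        rw [hJ.cx_apply X hae.ne, antisymSign_of_gt μ hae, antisymSign_of_gt μ hab',
          hS e b a ha he hb]
        ring
  refine congrArg Subtype.val (mTheta_ext (X := J Y)
    (Y := ⟨AdK g (J X), AdK_mem_mTheta hg (J X).2⟩) fun a b h => ?_)
  by_cases ha : a.val < d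
  · exact key a b ha
  · rw [cx_skew _ b a, key b a (h.resolve_left ha), ← cx_skew _ b a]

theorem IsStandard.invariant_integrable_iff (hJ : IsStandard J μ) :
    (KThetaInvariant J ∧ Integrable J) ↔ SignCondition l d μ := by
  constructor
  · rintro ⟨hK, hI⟩
    refine ⟨?_, fun k j s hj hs hsj hjk =>
      (hJ.signTriple_iff hj hs hsj hjk).2 (hJ.integrable_iff.1 hI k j s hj hs hsj hjk)⟩
    by_cases hd : d < l
    · have hl : l - 1 < l := by omega
      refine ⟨fun j => if j.val < d then μ ⟨l - 1, hl⟩ j else 1, fun j => ?_, fun k j hj hk => ?_⟩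
      · dsimp only
        split_ifs with hj
        · exact hJ.sign _ j hj (Fin.lt_def.2 (by dsimp only; omega))
        · exact Or.inl rfl
      · dsimp only
        rw [if_pos hj]
        exact hJ.sign_const hK hj (by dsimp only; omega) hk
    · exact ⟨fun _ => 1, fun _ => Or.inl rfl, fun k _ _ hk => absurd k.isLt (by omega)⟩
  · rintro ⟨⟨ε, -, hε⟩, h⟩
    refine ⟨hJ.invariant fun k k' j hj hk hk' => ?_, hJ.integrable_iff.2 fun k j s hj hs hsj hjk =>
      (hJ.signTriple_iff hj hs hsj hjk).1 (h k j s hj hs hsj hjk)⟩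
    rw [hε k j hj hk, hε k' j hj hk']

end Standard

/-! ### Invariant integrable structures are standard -/

theorem cx_lie_of_diagonal {l : ℕ} {D : kAlg l} (hD : ∀ a b, a ≠ b → cx D a b = 0) (Z : kAlg l)
    (a b : Fin l) : cx ⁅D, Z⁆ a b = (cx D a a - cx D b b) * cx Z a b := by
  rw [cx_lie_apply, Finset.sum_sub_distrib, Finset.sum_eq_single a, Finset.sum_eq_single b]
  · ring
  · intro c _ hc
    rw [hD c b hc, mul_zero]
  · simp
  · intro c _ hc
    rw [hD a c hc.symm, zero_mul]
  · simp

theorem cx_self_eq {l : ℕ} (X : kAlg l) (a : Fin l) : cx X a a = (cx X a a).im * Complex.I := by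
  have h := congrArg Complex.re (cx_skew X a a)
  simp only [Complex.star_def, Complex.neg_re, Complex.conj_re] at h
  have h0 : (cx X a a).re = 0 := by linarith
  apply Complex.ext <;> simp [h0]

/-- An element of `𝔨` supported at the entries `(k, j)` and `(j, k)` is a combination of `A_{kj}`
and `S_{kj}`. -/
theorem eq_smul_A_add_smul_S {l : ℕ} {k j : Fin l} (hjk : j < k) {Z : kAlg l}
    (hZ : ∀ a b, ¬(a = k ∧ b = j) → ¬(a = j ∧ b = k) → cx Z a b = 0) :
    Z = (cx Z k j).re • A k j + (cx Z k j).im • S k j := by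
  apply cx_injective
  intro a b
  rw [map_add, map_smul, map_smul, Matrix.add_apply, Matrix.smul_apply, Matrix.smul_apply, cx_A,
    cx_S, Matrix.sub_apply, Matrix.add_apply]
  by_cases h1 : a = k ∧ b = j
  · obtain ⟨rfl, rfl⟩ := h1
    apply Complex.ext <;> simp [hjk.ne]
  by_cases h2 : a = j ∧ b = k
  · obtain ⟨rfl, rfl⟩ := h2
    rw [cx_skew Z b a]
    apply Complex.ext <;> simp [hjk.ne']
  rw [hZ a b h1 h2, Matrix.single_apply_of_ne (h := fun e => h1 ⟨e.1.symm, e.2.symm⟩),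
    Matrix.single_apply_of_ne (h := fun e => h2 ⟨e.1.symm, e.2.symm⟩)]
  simp

section Invariant

variable {l d : ℕ} {J : Module.End ℝ (mTheta l d)}

theorem KThetaInvariant.map_longPart (hJ : KThetaInvariant J) {X : mTheta l d}
    (hX : (X : kAlg l) ∈ longPart l d) : (J X : kAlg l) ∈ longPart l d := by
  refine mem_longPart _ fun a b hab => ?_
  have h := hJ.cx_flip a (X := X) (Y := X) (fun e f => by
    by_cases hef : e = f
    · subst hef
      split_ifs <;> ring
    · rw [cx_eq_zero_of_mem_longPart hX hef]
      ring) a b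
  rw [if_pos rfl, if_neg hab.symm] at h
  linear_combination h / 2

/-- An invariant structure preserves `𝔨_{λ_j - λ_k} ⊕ 𝔨_{λ_j + λ_k}`: the changes of sign of the
coordinates `j` and `k` both act by `-1` there, and only there. -/
theorem KThetaInvariant.cx_eq_zero_of_support (hJ : KThetaInvariant J) {k j : Fin l} (hjk : j < k)
    {X : mTheta l d}
    (hX : ∀ a b, ¬(a = k ∧ b = j) → ¬(a = j ∧ b = k) → cx (X : kAlg l) a b = 0)
    (a b : Fin l) (h1 : ¬(a = k ∧ b = j)) (h2 : ¬(a = j ∧ b = k)) :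
    cx (J X : kAlg l) a b = 0 := by
  have key : ∀ i, i = j ∨ i = k → -cx (J X : kAlg l) a b =
      (if a = i then -1 else 1) * cx (J X : kAlg l) a b * (if b = i then -1 else 1) := by
    intro i hi
    have h := hJ.cx_flip i (X := X) (Y := -X) (fun e f => by
      rw [Submodule.coe_neg, map_neg, Matrix.neg_apply]
      by_cases h3 : e = k ∧ f = j
      · obtain ⟨rfl, rfl⟩ := h3
        rcases hi with rfl | rfl <;> simp [hjk.ne, hjk.ne']
      by_cases h4 : e = j ∧ f = k
      · obtain ⟨rfl, rfl⟩ := h4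
        rcases hi with rfl | rfl <;> simp [hjk.ne, hjk.ne']
      rw [hX e f h3 h4]
      ring) a b
    rwa [map_neg, Submodule.coe_neg, map_neg, Matrix.neg_apply] at h
  by_contra hne
  have hx : ∀ i, i = j ∨ i = k → (a = i ∧ b ≠ i) ∨ (a ≠ i ∧ b = i) := by
    intro i hi
    have h := key i hi
    by_cases ha : a = i <;> by_cases hb : b = i
    · rw [if_pos ha, if_pos hb] at h
      exact absurd (by linear_combination -h / 2) hne
    · exact Or.inl ⟨ha, hb⟩
    · exact Or.inr ⟨ha, hb⟩
    · rw [if_neg ha, if_neg hb] at h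
      exact absurd (by linear_combination -h / 2) hne
  rcases hx j (Or.inl rfl) with ⟨ha, -⟩ | ⟨-, hb⟩ <;>
    rcases hx k (Or.inr rfl) with ⟨ha', -⟩ | ⟨-, hb'⟩
  · exact hjk.ne (ha.symm.trans ha')
  · exact h2 ⟨ha, hb'⟩
  · exact h1 ⟨ha', hb⟩
  · exact hjk.ne (hb.symm.trans hb')

/-- The vanishing of `N_J(D, A_{kj})` for diagonal `D`, read off at the coefficient of `S_{kj}`. -/
theorem Integrable.diagonal_eq (hK : KThetaInvariant J) (hI : Integrable J) {k j : Fin l}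
    (hj : j.val < d) (hjk : j < k) {x y x' y' : ℝ}
    (hA : J ⟨A k j, A_mem hj hjk⟩ = x • ⟨A k j, A_mem hj hjk⟩ + y • ⟨S k j, S_mem hj hjk.le⟩)
    (hS : J ⟨S k j, S_mem hj hjk.le⟩ = x' • ⟨A k j, A_mem hj hjk⟩ + y' • ⟨S k j, S_mem hj hjk.le⟩)
    {D : mTheta l d} (hD : (D : kAlg l) ∈ longPart l d) :
    (x - y') * ((cx (J D : kAlg l) k k).im - (cx (J D : kAlg l) j j).im) +
      (y ^ 2 - x * y' - 1) * ((cx (D : kAlg l) k k).im - (cx (D : kAlg l) j j).im) = 0 := by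
  set a : mTheta l d := ⟨A k j, A_mem hj hjk⟩ with ha
  set s : mTheta l d := ⟨S k j, S_mem hj hjk.le⟩ with hs
  have hlie : ∀ E : mTheta l d, (E : kAlg l) ∈ longPart l d →
      projM l d ⁅(E : kAlg l), (a : kAlg l)⁆ =
        ((cx (E : kAlg l) k k).im - (cx (E : kAlg l) j j).im) • s ∧
      projM l d ⁅(E : kAlg l), (s : kAlg l)⁆ =
        -(((cx (E : kAlg l) k k).im - (cx (E : kAlg l) j j).im) • a) := by
    intro E hE
    have hE' : ∀ e f, e ≠ f → cx (E : kAlg l) e f = 0 := fun e f hef =>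
      cx_eq_zero_of_mem_longPart hE hef
    constructor
    · refine mTheta_ext fun e f hef => ?_
      rw [cx_projM _ hef, cx_lie_of_diagonal hE', cx_self_eq _ e, cx_self_eq _ f,
        Submodule.coe_smul, map_smul, Matrix.smul_apply, ha, hs, cx_A, cx_S, Matrix.sub_apply,
        Matrix.add_apply, Complex.real_smul]
      push_cast
      by_cases h1 : k = e ∧ j = f
      · obtain ⟨rfl, rfl⟩ := h1
        rw [Matrix.single_apply_of_ne (h := fun e => hjk.ne e.1)]
        ring
      rw [Matrix.single_apply_of_ne (h := h1)]
      by_cases h2 : j = e ∧ k = f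
      · obtain ⟨rfl, rfl⟩ := h2
        ring
      rw [Matrix.single_apply_of_ne (h := h2)]
      ring
    · refine mTheta_ext fun e f hef => ?_
      rw [cx_projM _ hef, cx_lie_of_diagonal hE', cx_self_eq _ e, cx_self_eq _ f,
        Submodule.coe_neg, Submodule.coe_smul, map_neg, map_smul, Matrix.neg_apply,
        Matrix.smul_apply, ha, hs, cx_A, cx_S, Matrix.sub_apply, Matrix.add_apply,
        Complex.real_smul]
      push_cast
      by_cases h1 : k = e ∧ j = f
      · obtain ⟨rfl, rfl⟩ := h1
        rw [Matrix.single_apply_of_ne (h := fun e => hjk.ne e.1)]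
        linear_combination (((cx (E : kAlg l) k k).im : ℂ) - (cx (E : kAlg l) j j).im) *
          (Matrix.single k j (1 : ℂ) : Matrix _ _ ℂ) k j * Complex.I_mul_I
      rw [Matrix.single_apply_of_ne (h := h1)]
      by_cases h2 : j = e ∧ k = f
      · obtain ⟨rfl, rfl⟩ := h2
        linear_combination (((cx (E : kAlg l) j j).im : ℂ) - (cx (E : kAlg l) k k).im) *
          (Matrix.single j k (1 : ℂ) : Matrix _ _ ℂ) j k * Complex.I_mul_I
      rw [Matrix.single_apply_of_ne (h := h2)]
      ring
  have hJD := hlie _ (hK.map_longPart hD)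
  have hD' := hlie _ hD
  have hN := hI D a
  rw [nijenhuis, hA] at hN
  simp only [Submodule.coe_add, Submodule.coe_smul, lie_add, lie_smul, map_add, map_smul, map_neg,
    hJD.1, hJD.2, hD'.1, hD'.2, hA, hS] at hN
  have h := congrArg (fun Z : mTheta l d => (cx (Z : kAlg l) k j).im) hN
  simp [ha, hs, cx_A, cx_S, hjk.ne] at h
  linear_combination h

/-- On each plane spanned by `A_{kj}` and `S_{kj}` an invariant integrable `J` is a rotation by a
right angle. The brackets with the diagonal elements `S_{jj}` and `J S_{jj}` exclude all other
square roots of `-1`. -/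
theorem Integrable.exists_sign (hsq : ∀ X, J (J X) = -X) (hK : KThetaInvariant J)
    (hI : Integrable J) {k j : Fin l} (hj : j.val < d) (hjk : j < k) :
    ∃ y : ℝ, (y = 1 ∨ y = -1) ∧
      J ⟨A k j, A_mem hj hjk⟩ = y • ⟨S k j, S_mem hj hjk.le⟩ ∧
      J ⟨S k j, S_mem hj hjk.le⟩ = -(y • ⟨A k j, A_mem hj hjk⟩) := by
  have hA0 : ∀ a b, ¬(a = k ∧ b = j) → ¬(a = j ∧ b = k) → cx (A k j) a b = 0 := by
    intro a b h1 h2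
    rw [cx_A, Matrix.sub_apply, Matrix.single_apply_of_ne (h := fun e => h1 ⟨e.1.symm, e.2.symm⟩),
      Matrix.single_apply_of_ne (h := fun e => h2 ⟨e.1.symm, e.2.symm⟩), sub_zero]
  have hS0 : ∀ a b, ¬(a = k ∧ b = j) → ¬(a = j ∧ b = k) → cx (S k j) a b = 0 := by
    intro a b h1 h2
    rw [cx_S, Matrix.add_apply, Matrix.single_apply_of_ne (h := fun e => h1 ⟨e.1.symm, e.2.symm⟩),
      Matrix.single_apply_of_ne (h := fun e => h2 ⟨e.1.symm, e.2.symm⟩), add_zero, mul_zero]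
  obtain ⟨x, y, hA⟩ : ∃ x y : ℝ, J ⟨A k j, A_mem hj hjk⟩ =
      x • ⟨A k j, A_mem hj hjk⟩ + y • ⟨S k j, S_mem hj hjk.le⟩ :=
    ⟨_, _, Subtype.ext (eq_smul_A_add_smul_S hjk
      (hK.cx_eq_zero_of_support hjk (X := ⟨A k j, A_mem hj hjk⟩) hA0))⟩
  obtain ⟨x', y', hS⟩ : ∃ x y : ℝ, J ⟨S k j, S_mem hj hjk.le⟩ =
      x • ⟨A k j, A_mem hj hjk⟩ + y • ⟨S k j, S_mem hj hjk.le⟩ :=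
    ⟨_, _, Subtype.ext (eq_smul_A_add_smul_S hjk
      (hK.cx_eq_zero_of_support hjk (X := ⟨S k j, S_mem hj hjk.le⟩) hS0))⟩
  have h2 := congrArg (fun Z : mTheta l d => cx (Z : kAlg l) k j) (hsq ⟨A k j, A_mem hj hjk⟩)
  rw [hA, map_add, map_smul, map_smul, hA, hS] at h2
  have hre := congrArg Complex.re h2
  have him := congrArg Complex.im h2
  simp [cx_A, cx_S, hjk.ne] at hre him
  have hD : (((⟨S j j, S_mem hj le_rfl⟩ : mTheta l d)) : kAlg l) ∈ longPart l d :=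
    Submodule.mem_iSup_of_mem j (Submodule.mem_iSup_of_mem hj (S_mem_kRoot j j))
  have e1 := hI.diagonal_eq hK hj hjk hA hS hD
  have e2 := hI.diagonal_eq hK hj hjk hA hS (hK.map_longPart hD)
  rw [hsq] at e2
  set t' := (cx (J ⟨S j j, S_mem hj le_rfl⟩ : kAlg l) k k).im -
    (cx (J ⟨S j j, S_mem hj le_rfl⟩ : kAlg l) j j).im
  have ht : (cx (S j j) k k).im - (cx (S j j) j j).im = -2 := by
    simp [cx_S, hjk.ne]
    norm_num
  simp only [Submodule.coe_neg, map_neg, Matrix.neg_apply, Complex.neg_im] at e2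
  have ht2 : -(cx (S j j) k k).im - -(cx (S j j) j j).im = 2 := by linear_combination -ht
  rw [ht] at e1
  rw [ht2] at e2
  have hpos : t' ^ 2 + 4 ≠ 0 := by positivity
  have hc : y ^ 2 - x * y' - 1 = 0 :=
    (mul_eq_zero.1 (show (t' ^ 2 + 4) * (y ^ 2 - x * y' - 1) = 0 by
      linear_combination -2 * e1 + t' * e2)).resolve_left hpos
  have hx : x - y' = 0 :=
    (mul_eq_zero.1 (show (t' ^ 2 + 4) * (x - y') = 0 by
      linear_combination t' * e1 + 2 * e2)).resolve_left hpos
  have hy : y ≠ 0 := by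
    rintro rfl
    nlinarith [sq_nonneg x]
  have hx0 : x = 0 := by
    have : y * (x + y') = 0 := by linear_combination him
    have := (mul_eq_zero.1 this).resolve_left hy
    linarith
  have hy'0 : y' = 0 := by linarith
  subst hx0 hy'0
  have hy2 : y * y = 1 := by linear_combination hc
  have hx' : x' = -y := by linear_combination -x' * hy2 + y * hre
  refine ⟨y, mul_self_eq_one_iff.1 hy2, ?_, ?_⟩
  · rw [hA, zero_smul, zero_add]
  · rw [hS, hx', zero_smul, add_zero, neg_smul]

theorem exists_isStandard (hsq : ∀ X, J (J X) = -X) (hK : KThetaInvariant J)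
    (hI : Integrable J) : ∃ μ : Fin l → Fin l → ℝ, IsStandard J μ := by
  have key : ∀ k j : Fin l, ∃ y : ℝ, ∀ (hj : j.val < d) (hjk : j < k), (y = 1 ∨ y = -1) ∧
      J ⟨A k j, A_mem hj hjk⟩ = y • ⟨S k j, S_mem hj hjk.le⟩ ∧
      J ⟨S k j, S_mem hj hjk.le⟩ = -(y • ⟨A k j, A_mem hj hjk⟩) := by
    intro k j
    by_cases h : j.val < d ∧ j < k
    · obtain ⟨y, hy⟩ := hI.exists_sign hsq hK h.1 h.2
      exact ⟨y, fun _ _ => hy⟩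
    · exact ⟨0, fun hj hjk => absurd ⟨hj, hjk⟩ h⟩
  choose μ hμ using key
  exact ⟨μ, hsq, fun X hX => hK.map_longPart hX, fun k j hj hjk => (hμ k j hj hjk).1,
    fun k j hj hjk => (hμ k j hj hjk).2.1, fun k j hj hjk => (hμ k j hj hjk).2.2⟩

end Invariant

/-! ### Invariant structures on the flag manifold -/

/-- The isotropy algebra at the origin is `𝔨_Θ`: skew-symmetric elements of `𝔭_Θ` preserve the
height. -/
theorem isotropy_origin (l d : ℕ) : isotropy (Flag.origin l d) = kTheta l d := by
  have hle : kTheta l d ≤ isotropy (Flag.origin l d) := by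
    intro X hX
    refine (mem_parab_iff (X := (X : Mat l))).2 ⟨X.2.1, fun a b hab => ?_⟩
    refine kTheta_le hX a b ?_
    by_contra! hc
    rcases a with a | a <;> rcases b with b | b <;>
      simp only [hgt, idx, Sum.elim_inl, Sum.elim_inr, id] at hab hc <;> omega
  refine le_antisymm (fun X hX => ?_) hle
  have hp := (mem_parab_iff.1 (show (X : Mat l) ∈ parab l d from hX)).2
  have hso : (X : Mat l)ᵀ = -X :=
    (LieAlgebra.Orthogonal.mem_so (Fin l ⊕ Fin l) ℝ (X : Mat l)).1 X.2.2
  have hsymm : ∀ a b, (X : Mat l) b a = -(X : Mat l) a b := fun a b => congrFun (congrFun hso a) b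
  rw [← Submodule.projectionOnto_apply_eq_zero_iff (isCompl_mTheta_kTheta l d)]
  refine mTheta_ext fun a b hab => ?_
  refine (cx_projM X hab).trans ?_
  rw [Submodule.coe_zero, map_zero, Matrix.zero_apply]
  refine cx_apply_eq_zero X fun p q hpa hqb => ?_
  rcases lt_trichotomy (hgt d p) (hgt d q) with h | h | h
  · exact hp p q h
  · have hpq : p = q := by
      subst hpa hqb
      rcases p with p | p <;> rcases q with q | q <;>
        simp only [hgt, idx, Sum.elim_inl, Sum.elim_inr, id] at h hab
      · rw [Fin.ext (show p.val = q.val by omega)]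
      · omega
      · omega
      · rw [Fin.ext (show p.val = q.val by omega)]
    subst hpq
    linarith [hsymm p p]
  · rw [hsymm q p, hp q p h, neg_zero]

theorem tangentClass_origin_projM {l d : ℕ} (Z : kAlg l) :
    tangentClass (Flag.origin l d) (projM l d Z : kAlg l) = tangentClass (Flag.origin l d) Z := by
  rw [← sub_eq_zero, ← map_sub, Submodule.mkQ_apply, Submodule.Quotient.mk_eq_zero,
    isotropy_origin, ← Submodule.projectionOnto_apply_eq_zero_iff (isCompl_mTheta_kTheta l d),
    map_sub, Submodule.projectionOnto_apply_left, sub_eq_zero]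
  rfl

theorem tangentClass_origin_injective {l d : ℕ} {X Y : mTheta l d}
    (h : tangentClass (Flag.origin l d) (X : kAlg l) = tangentClass (Flag.origin l d) Y) :
    X = Y := by
  rw [← sub_eq_zero, ← map_sub, Submodule.mkQ_apply, Submodule.Quotient.mk_eq_zero,
    isotropy_origin] at h
  rw [← sub_eq_zero]
  exact Subtype.ext ((Submodule.disjoint_def.1 (isCompl_mTheta_kTheta l d).disjoint) _
    (X - Y).2 h)

/-- Every field on the flag manifold is induced by an endomorphism of `𝔪_Θ` at the origin. -/
theorem exists_isInducedBy {l d : ℕ} (I : (q : Flag l d) → Module.End ℝ (Tangent q)) :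
    ∃ J : Module.End ℝ (mTheta l d), IsInducedBy I J := by
  have hker : isotropy (Flag.origin l d) ≤ LinearMap.ker (projM l d) := by
    rw [isotropy_origin]
    exact (Submodule.ker_projectionOnto (isCompl_mTheta_kTheta l d)).ge
  refine ⟨(isotropy (Flag.origin l d)).liftQ (projM l d) hker ∘ₗ I (Flag.origin l d) ∘ₗ
    (isotropy (Flag.origin l d)).mkQ ∘ₗ (mTheta l d).subtype, fun X => ?_⟩
  obtain ⟨Z, hZ⟩ := (isotropy (Flag.origin l d)).mkQ_surjective
    (I (Flag.origin l d) (tangentClass _ (X : kAlg l)))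
  have : (isotropy (Flag.origin l d)).liftQ (projM l d) hker
      (I (Flag.origin l d) (tangentClass _ (X : kAlg l))) = projM l d Z := by
    rw [← hZ]
    rfl
  change _ = tangentClass _ (((isotropy (Flag.origin l d)).liftQ (projM l d) hker
      (I (Flag.origin l d) (tangentClass _ (X : kAlg l))) : mTheta l d) : kAlg l)
  rw [this, tangentClass_origin_projM]
  exact hZ.symm

section Induced

variable {l d : ℕ} {I : (q : Flag l d) → Module.End ℝ (Tangent q)}
  {J : Module.End ℝ (mTheta l d)}

theorem IsInducedBy.sq (h : IsInducedBy I J) (hI : IsInvariantAlmostComplex I)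
    (X : mTheta l d) : J (J X) = -X := by
  apply tangentClass_origin_injective
  rw [← h (J X), ← h X, hI.sq]
  exact (map_neg (isotropy (Flag.origin l d)).mkQ (X : kAlg l)).symm

theorem IsInducedBy.invariant (h : IsInducedBy I J) (hI : IsInvariantAlmostComplex I) :
    KThetaInvariant J := by
  intro g hg X Y hY
  have h1 := hI.inv g (Flag.origin l d) (Flag.origin l d) hg.2.symm X (J X) (h X)
  rw [← hY, h Y] at h1
  exact congrArg Subtype.val (tangentClass_origin_injective (X := J Y)
    (Y := ⟨AdK g (J X), AdK_mem_mTheta hg (J X).2⟩) h1)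

theorem IsInducedBy.integrable (h : IsInducedBy I J) (hI : IsIntegrableField I) :
    Integrable J := by
  intro X Y
  apply tangentClass_origin_injective
  have h1 := hI (Flag.origin l d) X Y (J X) (J Y) (h X) (h Y)
  rw [← tangentClass_origin_projM, ← tangentClass_origin_projM ⁅(X : kAlg l), (Y : kAlg l)⁆,
    ← tangentClass_origin_projM ⁅(J X : kAlg l), (Y : kAlg l)⁆,
    ← tangentClass_origin_projM ⁅(X : kAlg l), (J Y : kAlg l)⁆, h, h, ← map_sub, ← map_sub,
    ← map_sub] at h1
  exact h1.trans (map_zero _).symm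

end Induced

end FlagC

theorem mainTheorem5 (l d : ℕ) (hl : l ≠ 4) (hd : d ≤ l) (hev : Even d) :
    (∀ (J : Module.End ℝ (FlagC.mTheta l d)) (μ : Fin l → Fin l → ℝ), FlagC.IsStandard J μ →
      ((FlagC.KThetaInvariant J ∧ FlagC.Integrable J) ↔ FlagC.SignCondition l d μ)) ∧
    ∀ I : (q : FlagC.Flag l d) → Module.End ℝ (FlagC.Tangent q),
      FlagC.IsInvariantAlmostComplex I → FlagC.IsIntegrableField I →
        ∃ (J : Module.End ℝ (FlagC.mTheta l d)) (μ : Fin l → Fin l → ℝ),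
          FlagC.IsStandard J μ ∧ FlagC.SignCondition l d μ ∧ FlagC.IsInducedBy I J := by
  refine ⟨fun J μ hJ => hJ.invariant_integrable_iff, fun I hI hint => ?_⟩
  obtain ⟨J, hJ⟩ := FlagC.exists_isInducedBy I
  obtain ⟨μ, hμ⟩ := FlagC.exists_isStandard (hJ.sq hI) (hJ.invariant hI) (hJ.integrable hint)
  exact ⟨J, μ, hμ, hμ.invariant_integrable_iff.1 ⟨hJ.invariant hI, hJ.integrable hint⟩, hJ⟩
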